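/- Let $c,d,t,c_1$ be integers with $t\ge 1$, $d\ge 2t+1$, $c_1\ge 2$ and $(c-c_1+1)\frac{t}{t+1}>1$. Let $h(\tau_1,\dots,\tau_i)=-\sum_{j\le i}\tau_j\log\tau_j-(1-\sum_{j\le i}\tau_j)\log(1-\sum_{j\le i}\tau_j)$ (natural logarithms, $0\log 0=0$), and let $$F_0(x)=\sum_{j=c-c_1+1}^{c}\tbinom cj x^j,\quad F_1(x)=\sum_{j=0}^{c-c_1}\tbinom cj x^j,\quad F_2(x)=\sum_{j=c_1}^{c}\tbinom cj x^j,\quad F_3(x)=\sum_{j=0}^{c_1-1}\tbinom cj x^j,$$ $$G_0(x)=\sum_{j=t+1}^{d}\tbinom dj x^j,\qquad G_1(x)=\sum_{j=0}^{t}\tbinom dj x^j.$$ Put $\rho=t_1+t_2+u_1+u_2\in[-\infty,\infty)$, where $$t_1=\inf_{x>0}\{\gamma\log F_0(x)+(\alpha-\gamma)\log F_1(x)-\omega c\log x\},\quad t_2=\inf_{x>0}\{\delta\log F_2(x)+(1-\alpha-\delta)\log F_3(x)-(\phi-\omega)c\log x\},$$ $$u_1=\inf_{x>0}\{\tfrac{\phi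 c}{d}\log G_0(x)-\omega c\log x\},\quad u_2=\inf_{x>0}\{\tfrac{(1-\phi)c}{d}\log G_1(x)-(\alpha-\omega)c\log x\},$$ and $$\psi=h(\gamma,\alpha-\gamma,\delta)+\tfrac cd h(\phi)+\rho-c\,h(\omega,\alpha-\omega,\phi-\omega),$$ $$\tilde\psi=\alpha h(\gamma/\alpha)+(1-\alpha)h(\delta/(1-\alpha))+\tfrac cd h(\phi)+\rho-c\,h(\omega,\alpha-\omega,\phi-\omega)$$ (at $\alpha=1$ the second term of $\tilde\psi$ is $0$). Call $(\gamma,\delta,\phi,\omega)$ feasible for $\alpha$ if $0\le\gamma\le\alpha$, $0\le\delta\le 1-\alpha$, $0\le\omega\le\min(\alpha,\phi)$, $\alpha-\omega\le 1-\phi$, $\phi\le\frac{\omega d}{t+1}$, $\delta\le\frac{(\phi-\omega)c}{c_1}$ and $\gamma\le\frac{\omega c}{c-c_1+1}$. Let $f(\alpha)$ be the maximum of $\psi$ over the feasible points with $\delta\ge\alpha-\gamma$, and $\tilde f(\alpha,\nu)$ the maximum of $\tilde\psi$ over the feasible points with $\gamma+\delta\ge\nu$ (a maximum over the empty set is $-\infty$).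 Let $\mathcal C_0\subseteq\mathrm{GF}(2)^d$ be a linear code with minimum distance at least $2t+1$. For $N$ with $d\mid Nc$, choose a code from the $(c,d)$-regular GLDPC ensemble: match the $Nc$ sockets of $N$ variable nodes ($c$ sockets each) with the $Nc$ sockets of $J=Nc/d$ check nodes ($d$ sockets each) by a uniformly random bijection; the codewords are the $x\in\{0,1\}^N$ for which the $d$ bits seen by each check node form a word of $\mathcal C_0$. In each iteration of the parallel bit flipping bounded distance decoder, each check node that sees a word at Hamming distance at most $t$ from a word $w\in\mathcal C_0$ sends a flip message over each of its edges on which the current value differs from $w$; then all variables that received at least $c_1$ flip messages (counted with edge multiplicity) are flipped. The iterations continue until nothing changes. **Theorem.** The function $f$ has a smallest positive root $\alpha_0$, and there is a largest positive number $\alpha_R$ such that $\tilde f(\alpha,\alpha_0)<0$ for all $0<\alpha<\alpha_R$. Both depend only on $c,d,t,c_1$. If $0\le\alpha<\alpha_R$, and a codeword of a random code of the ensemble is corrupted in $\lfloor\alpha N\rfloor$ positions chosen uniformly at random, independently of the code, then with probability tending to $1$ as $N\to\infty$ the decoder recovers the transmitted codeword (for every choice of the transmitted codeword). -/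

import Mathlib

open Filter Topology

namespace GLDPC

noncomputable section

/-! ### Exponent functions -/

/-- The entropy function `h(τ₁, …, τᵢ)` (natural logarithm, `0 log 0 = 0`): the numbers `τ₁, …, τᵢ`
are completed by `1 - ∑ τⱼ`. -/
def entropy {n : ℕ} (τ : Fin n → ℝ) : ℝ :=
  (∑ j, Real.negMulLog (τ j)) + Real.negMulLog (1 - ∑ j, τ j)

/-- `∑_{j=a}^{b} binom(n,j) x^j`. -/
def binomPoly (n a b : ℕ) (x : ℝ) : ℝ := ∑ j ∈ Finset.Icc a b, (n.choose j : ℝ) * x ^ j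

def F0 (c c₁ : ℕ) (x : ℝ) : ℝ := binomPoly c (c - c₁ + 1) c x
def F1 (c c₁ : ℕ) (x : ℝ) : ℝ := binomPoly c 0 (c - c₁) x
def F2 (c c₁ : ℕ) (x : ℝ) : ℝ := binomPoly c c₁ c x
def F3 (c c₁ : ℕ) (x : ℝ) : ℝ := binomPoly c 0 (c₁ - 1) x
def G0 (d t : ℕ) (x : ℝ) : ℝ := binomPoly d (t + 1) d x
def G1 (d t : ℕ) (x : ℝ) : ℝ := binomPoly d 0 t x

/-- Infimum over `x > 0` of a real expression. The value is an extended real, since the infimum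
can be `-∞`. -/
def infPos (g : ℝ → ℝ) : EReal := ⨅ x ∈ Set.Ioi (0 : ℝ), (g x : EReal)

def t1 (c c₁ : ℕ) (α γ ω : ℝ) : EReal :=
  infPos fun x => γ * Real.log (F0 c c₁ x) + (α - γ) * Real.log (F1 c c₁ x)
    - ω * c * Real.log x

def t2 (c c₁ : ℕ) (α δ φ ω : ℝ) : EReal :=
  infPos fun x => δ * Real.log (F2 c c₁ x) + (1 - α - δ) * Real.log (F3 c c₁ x)
    - (φ - ω) * c * Real.log x

def u1 (c d t : ℕ) (φ ω : ℝ) : EReal :=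
  infPos fun x => φ * c / d * Real.log (G0 d t x) - ω * c * Real.log x

def u2 (c d t : ℕ) (α φ ω : ℝ) : EReal :=
  infPos fun x => (1 - φ) * c / d * Real.log (G1 d t x) - (α - ω) * c * Real.log x

def rho (c d t c₁ : ℕ) (α γ δ φ ω : ℝ) : EReal :=
  t1 c c₁ α γ ω + t2 c c₁ α δ φ ω + u1 c d t φ ω + u2 c d t α φ ω

def psi (c d t c₁ : ℕ) (α γ δ φ ω : ℝ) : EReal :=
  ((entropy ![γ, α - γ, δ] + (c : ℝ) / d * entropy ![φ]
      - c * entropy ![ω, α - ω, φ - ω] : ℝ) : EReal)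
    + rho c d t c₁ α γ δ φ ω

/-- The variant of `psi` in which the set of corrupt variables is fixed. -/
def psiR (c d t c₁ : ℕ) (α γ δ φ ω : ℝ) : EReal :=
  ((α * entropy ![γ / α] + (1 - α) * entropy ![δ / (1 - α)] + (c : ℝ) / d * entropy ![φ]
      - c * entropy ![ω, α - ω, φ - ω] : ℝ) : EReal)
    + rho c d t c₁ α γ δ φ ω

/-- The constraints on `γ, δ, φ, ω` common to both maximizations. (They imply
`ω d / (t+1) ≤ α d / (t+1)` and `(φ - ω) c / c₁ ≤ φ c / c₁ ≤ α d c / ((t+1) c₁)`.) -/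
structure Feasible (c d t c₁ : ℕ) (α γ δ φ ω : ℝ) : Prop where
  gamma_nonneg : 0 ≤ γ
  gamma_le : γ ≤ α
  delta_nonneg : 0 ≤ δ
  delta_le : δ ≤ 1 - α
  omega_nonneg : 0 ≤ ω * c
  omega_le : ω * c ≤ min α φ * c
  edges_le : (α - ω) * c ≤ (1 - φ) * c
  phi_le : φ ≤ ω * d / (t + 1)
  delta_le' : δ ≤ (φ - ω) * c / c₁
  gamma_le' : γ ≤ ω * c / ((c : ℝ) - c₁ + 1)

/-- `f(α)`: the maximum of `psi` over the feasible `γ, δ, φ, ω` with `δ ≥ α - γ`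
(`-∞` if there are none). -/
def f (c d t c₁ : ℕ) (α : ℝ) : EReal :=
  sSup {y | ∃ γ δ φ ω : ℝ, Feasible c d t c₁ α γ δ φ ω ∧ α - γ ≤ δ ∧
    y = psi c d t c₁ α γ δ φ ω}

/-- `f̃(α, ν)`: the maximum of `psiR` over the feasible `γ, δ, φ, ω` with `γ + δ ≥ ν`
(`-∞` if there are none). -/
def fR (c d t c₁ : ℕ) (α ν : ℝ) : EReal :=
  sSup {y | ∃ γ δ φ ω : ℝ, Feasible c d t c₁ α γ δ φ ω ∧ ν ≤ γ + δ ∧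
    y = psiR c d t c₁ α γ δ φ ω}

/-! ### Codes, the ensemble, the decoder -/

/-- A Tanner graph of the `(c,d)`-regular ensemble with `N` variable nodes and `J` check nodes:
a matching of the `N c` variable sockets with the `J d` check sockets. Parallel edges may occur. -/
abbrev Tanner (N c J d : ℕ) := (Fin N × Fin c) ≃ (Fin J × Fin d)

variable {N c J d : ℕ}

/-- The values of the `d` variable nodes connected to check node `j`. -/
def checkInput (π : Tanner N c J d) (v : Fin N → ZMod 2) (j : Fin J) : Fin d → ZMod 2 :=
  fun m => v (π.symm (j, m)).1

/-- The codewords of the GLDPC code with Tanner graph `π` and component code `C₀`. -/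
def IsCodeword (C₀ : Submodule (ZMod 2) (Fin d → ZMod 2)) (π : Tanner N c J d)
    (x : Fin N → ZMod 2) : Prop :=
  ∀ j, checkInput π x j ∈ C₀

open Classical in
/-- `t`-bounded distance decoding for `C₀`; `none` stands for `NULL`. The codeword at distance at
most `t` is unique if the minimum distance of `C₀` is at least `2t+1`. -/
def BDD (C₀ : Submodule (ZMod 2) (Fin d → ZMod 2)) (t : ℕ) (y : Fin d → ZMod 2) :
    Option (Fin d → ZMod 2) :=
  if h : ∃ w ∈ C₀, hammingDist w y ≤ t then some h.choose else none

/-- Check socket `s = (j, m)` carries a flip message: bounded distance decoding at `j` succeeds and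
its `m`-th component differs from the current value of the variable attached to `s`. -/
def SendsFlip (C₀ : Submodule (ZMod 2) (Fin d → ZMod 2)) (t : ℕ) (π : Tanner N c J d)
    (v : Fin N → ZMod 2) (s : Fin J × Fin d) : Prop :=
  ∃ w, BDD C₀ t (checkInput π v s.1) = some w ∧ w s.2 ≠ checkInput π v s.1 s.2

open Classical in
/-- The number of flip messages that variable `i` receives, counted with edge multiplicity. -/
def flipCount (C₀ : Submodule (ZMod 2) (Fin d → ZMod 2)) (t : ℕ) (π : Tanner N c J d)
    (v : Fin N → ZMod 2) (i : Fin N) : ℕ :=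
  (Finset.univ.filter fun k : Fin c => SendsFlip C₀ t π v (π (i, k))).card

/-- One iteration of parallel bit flipping bounded distance decoding with threshold `c₁`. -/
def step (C₀ : Submodule (ZMod 2) (Fin d → ZMod 2)) (t c₁ : ℕ) (π : Tanner N c J d)
    (v : Fin N → ZMod 2) : Fin N → ZMod 2 :=
  fun i => if c₁ ≤ flipCount C₀ t π v i then v i + 1 else v i

/-- The word `x` with the bits at the positions in `E` flipped. -/
def corrupt (x : Fin N → ZMod 2) (E : Finset (Fin N)) : Fin N → ZMod 2 :=
  fun i => if i ∈ E then x i + 1 else x i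

/-- Started from `v`, the decoder gets stuck at `x` after finitely many iterations. -/
def DecodesTo (C₀ : Submodule (ZMod 2) (Fin d → ZMod 2)) (t c₁ : ℕ) (π : Tanner N c J d)
    (v x : Fin N → ZMod 2) : Prop :=
  ∀ᶠ l in atTop, (step C₀ t c₁ π)^[l] v = x

/-- Errors at the positions in `E` are corrected, whatever codeword was transmitted. -/
def Corrects (C₀ : Submodule (ZMod 2) (Fin d → ZMod 2)) (t c₁ : ℕ) (π : Tanner N c J d)
    (E : Finset (Fin N)) : Prop :=
  ∀ x, IsCodeword C₀ π x → DecodesTo C₀ t c₁ π (corrupt x E) x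

open Classical in
/-- The probability of successful decoding when the Tanner graph and, independently, the set of
`n` error positions are chosen uniformly at random. -/
def successProb (C₀ : Submodule (ZMod 2) (Fin d → ZMod 2)) (t c₁ N c J n : ℕ) : ℝ :=
  let Ω : Finset (Tanner N c J d × Finset (Fin N)) :=
    Finset.univ ×ˢ Finset.powersetCard n Finset.univ
  ((Ω.filter fun p => Corrects C₀ t c₁ p.1 p.2).card : ℝ) / (Ω.card : ℝ)

end

end GLDPC

/-! Call a check bad if it sees more than `t` errors. A good check decodes to the transmitted word,
so one iteration sends an error set `E` into `stay ∪ spread`: corrupt variables with at least `c -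
c₁ + 1` bad sockets and correct ones with at least `c₁` (`exists_step_corrupt`). Decoding succeeds
as soon as every nonempty set of at most `m` variables shrinks under this map and one iteration
brings the actual error set down to size `m` (`corrects_of_forall_shrink`). Neither condition
mentions the codeword, and a union bound over the random matching controls both
(`one_sub_successProb_le`).

For fixed `E`, matchings with given numbers of staying variables, spreading variables, bad checks
and edges from `E` to bad checks are counted by choosing these sets, then the socket patterns, then
a bijection respecting four socket classes. Bounding coefficients of generating functions by their
values at positive `x` gives a probability of at most a power of `|E|` times `exp (N * (psiAt -
h(|E|/N)))` (`card_growth_le`). Summing over all sets of that size cancels the entropy `h`; hence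
`psi` governs the shrinking of small sets and `psiR` the first iteration.

As `α → 0` the gain hypothesis makes the exponent at most `κ α log α + C α` with `κ > 0`
(`exists_psiAt_le`), which settles all sets of size at most `ε N` by dominated convergence. From `ε
N` up to a fraction below `α₀`, negativity of `f` and compactness give uniform exponential decay
(`exists_growth_bound`).

Since `psi` is an infimum of continuous functions, its nonnegativity is a closed condition, so there
is a least `α` admitting a point with `psi ≥ 0`. Scaling towards the origin shows that `f` cannot be
positive there, so this `α` is the root `α₀` (`exists_isLeast_root`). -/

namespace GLDPC

noncomputable section

/-! ### The exponents as infima of continuous functions -/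

/-- The entropy terms of `psi` at the point `p = (α, γ, δ, φ, ω)`. -/
def entropyPart (c d : ℕ) (p : Fin 5 → ℝ) : ℝ :=
  entropy ![p 1, p 0 - p 1, p 2] + (c : ℝ) / d * entropy ![p 3]
    - c * entropy ![p 4, p 0 - p 4, p 3 - p 4]

/-- The expression minimized in the definition of `rho`. -/
def rhoAt (c d t c₁ : ℕ) (x : Fin 4 → ℝ) (p : Fin 5 → ℝ) : ℝ :=
  (p 1 * Real.log (F0 c c₁ (x 0)) + (p 0 - p 1) * Real.log (F1 c c₁ (x 0))
      - p 4 * c * Real.log (x 0))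
  + (p 2 * Real.log (F2 c c₁ (x 1)) + (1 - p 0 - p 2) * Real.log (F3 c c₁ (x 1))
      - (p 3 - p 4) * c * Real.log (x 1))
  + (p 3 * c / d * Real.log (G0 d t (x 2)) - p 4 * c * Real.log (x 2))
  + ((1 - p 3) * c / d * Real.log (G1 d t (x 3)) - (p 0 - p 4) * c * Real.log (x 3))

/-- `psi` is the infimum of `psiAt` over positive `x`. -/
def psiAt (c d t c₁ : ℕ) (x : Fin 4 → ℝ) (p : Fin 5 → ℝ) : ℝ :=
  entropyPart c d p + rhoAt c d t c₁ x p

def FeasiblePt (c d t c₁ : ℕ) (p : Fin 5 → ℝ) : Prop :=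
  Feasible c d t c₁ (p 0) (p 1) (p 2) (p 3) (p 4)

theorem infPos_le (g : ℝ → ℝ) {x : ℝ} (hx : 0 < x) : infPos g ≤ g x :=
  iInf₂_le (f := fun x (_ : x ∈ Set.Ioi (0 : ℝ)) => (g x : EReal)) x hx

theorem infPos_ne_top (g : ℝ → ℝ) : infPos g ≠ ⊤ := fun h => by
  have := infPos_le g one_pos
  rw [h, top_le_iff] at this
  exact EReal.coe_ne_top _ this

theorem exists_of_infPos_lt {g : ℝ → ℝ} {a : EReal} (h : infPos g < a) :
    ∃ x, 0 < x ∧ (g x : EReal) < a := by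
  simpa [infPos, iInf_lt_iff] using h

/-- The hypothesis `a ≠ ⊤` is essential: in `EReal`, `⊤ + ⊥ = ⊥`, and the infimum may be `⊥`. -/
theorem le_add_infPos {g : ℝ → ℝ} {a b : EReal} (ha : a ≠ ⊤)
    (h : ∀ x, 0 < x → b ≤ a + g x) : b ≤ a + infPos g := by
  refine EReal.le_add_of_forall_gt (.inr (infPos_ne_top g)) (.inl ha) fun a' ha' b' hb' => ?_
  obtain ⟨x, hx, hxb⟩ := exists_of_infPos_lt hb'
  exact (h x hx).trans (add_le_add ha'.le hxb.le)

section
variable (c d t c₁ : ℕ)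

theorem coe_add_rho_le (H : ℝ) (p : Fin 5 → ℝ) {x : Fin 4 → ℝ} (hx : ∀ i, 0 < x i) :
    (H : EReal) + rho c d t c₁ (p 0) (p 1) (p 2) (p 3) (p 4)
      ≤ ((H + rhoAt c d t c₁ x p : ℝ) : EReal) := by
  rw [EReal.coe_add]
  refine add_le_add le_rfl ?_
  unfold rho rhoAt
  rw [EReal.coe_add, EReal.coe_add, EReal.coe_add]
  exact add_le_add (add_le_add (add_le_add (infPos_le _ (hx 0)) (infPos_le _ (hx 1)))
    (infPos_le _ (hx 2))) (infPos_le _ (hx 3))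

/-- The four infima have independent variables, so their sum is an infimum over one joint `x`. They
are replaced one at a time; commuting the sum brings the next infimum to the last place. -/
theorem le_coe_add_rho (H r : ℝ) (p : Fin 5 → ℝ)
    (h : ∀ x : Fin 4 → ℝ, (∀ i, 0 < x i) → r ≤ H + rhoAt c d t c₁ x p) :
    (r : EReal) ≤ (H : EReal) + rho c d t c₁ (p 0) (p 1) (p 2) (p 3) (p 4) := by
  unfold rho
  rw [← add_assoc, ← add_assoc, ← add_assoc]
  have n1 : (H : EReal) + t1 c c₁ (p 0) (p 1) (p 4) ≠ ⊤ :=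
    EReal.add_ne_top (EReal.coe_ne_top _) (infPos_ne_top _)
  have n2 := EReal.add_ne_top n1 (infPos_ne_top (fun x => p 2 * Real.log (F2 c c₁ x)
    + (1 - p 0 - p 2) * Real.log (F3 c c₁ x) - (p 3 - p 4) * c * Real.log x))
  have n3 := EReal.add_ne_top n2 (infPos_ne_top (fun x => p 3 * c / d * Real.log (G0 d t x)
    - p 4 * c * Real.log x))
  refine le_add_infPos n3 fun x3 h3 => ?_
  rw [add_right_comm]
  refine le_add_infPos (EReal.add_ne_top n2 (EReal.coe_ne_top _)) fun x2 h2 => ?_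
  rw [add_right_comm _ (t2 _ _ _ _ _ _), add_right_comm _ (t2 _ _ _ _ _ _)]
  refine le_add_infPos (EReal.add_ne_top (EReal.add_ne_top n1 (EReal.coe_ne_top _))
    (EReal.coe_ne_top _)) fun x1 h1 => ?_
  rw [add_right_comm _ (t1 _ _ _ _ _), add_right_comm _ (t1 _ _ _ _ _),
    add_right_comm _ (t1 _ _ _ _ _)]
  refine le_add_infPos (EReal.add_ne_top (EReal.add_ne_top (EReal.add_ne_top
    (EReal.coe_ne_top _) (EReal.coe_ne_top _)) (EReal.coe_ne_top _))
    (EReal.coe_ne_top _)) fun x0 h0 => ?_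
  rw [← EReal.coe_add, ← EReal.coe_add, ← EReal.coe_add, ← EReal.coe_add, EReal.coe_le_coe_iff]
  refine (h ![x0, x1, x2, x3] (by intro i; fin_cases i <;> assumption)).trans (le_of_eq ?_)
  simp [rhoAt]
  ring

theorem psi_le (p : Fin 5 → ℝ) {x : Fin 4 → ℝ} (hx : ∀ i, 0 < x i) :
    psi c d t c₁ (p 0) (p 1) (p 2) (p 3) (p 4) ≤ (psiAt c d t c₁ x p : EReal) :=
  coe_add_rho_le c d t c₁ _ p hx

theorem le_psi (p : Fin 5 → ℝ) (r : ℝ)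
    (h : ∀ x : Fin 4 → ℝ, (∀ i, 0 < x i) → r ≤ psiAt c d t c₁ x p) :
    (r : EReal) ≤ psi c d t c₁ (p 0) (p 1) (p 2) (p 3) (p 4) :=
  le_coe_add_rho c d t c₁ _ r p h

end

/-! ### Entropy identities -/

theorem entropy_one (a : ℝ) : entropy ![a] = Real.negMulLog a + Real.negMulLog (1 - a) := by
  simp [entropy]

theorem entropy_three (a b e : ℝ) : entropy ![a, b, e] =
    Real.negMulLog a + Real.negMulLog b + Real.negMulLog e + Real.negMulLog (1 - (a + b + e)) := by
  simp [entropy, Fin.sum_univ_three]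

theorem negMulLog_div {a y : ℝ} (ha : 0 < a) :
    a * Real.negMulLog (y / a) = Real.negMulLog y + y * Real.log a := by
  have h := Real.negMulLog_mul (y / a) a
  rw [div_mul_cancel₀ _ ha.ne'] at h
  rw [h]
  simp only [Real.negMulLog]
  field_simp
  ring

/-- The chain rule for the entropy of a partition refining `α, 1 - α`. -/
theorem entropy_chain {α γ δ : ℝ} (hα : 0 < α) (hα1 : α ≤ 1) (h0 : 0 ≤ δ) (hδ : δ ≤ 1 - α) :
    α * entropy ![γ / α] + (1 - α) * entropy ![δ / (1 - α)]
      = entropy ![γ, α - γ, δ] - entropy ![α] := by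
  have h1 : 1 - γ / α = (α - γ) / α := by field_simp
  rw [entropy_one, entropy_one, entropy_three, entropy_one, h1, mul_add, mul_add,
    negMulLog_div hα, negMulLog_div hα]
  have e1 : 1 - (γ + (α - γ) + δ) = 1 - α - δ := by ring
  rw [e1]
  rcases hα1.lt_or_eq with h | rfl
  · have hb : 0 < 1 - α := by linarith
    have h2 : 1 - δ / (1 - α) = (1 - α - δ) / (1 - α) := by field_simp
    rw [h2, negMulLog_div hb, negMulLog_div hb]
    simp only [Real.negMulLog]
    ring
  -- Here `α = 1`; the division by zero is harmless because its factor `1 - α` vanishes.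
  · have : δ = 0 := by linarith
    subst this
    simp

variable {c d t c₁ : ℕ}

/-- By the chain rule the two exponents differ by `h(α)`, the exponential rate of the number of
error sets of size `α N`. -/
theorem psiR_eq {p : Fin 5 → ℝ} (hp : FeasiblePt c d t c₁ p) (h0 : 0 < p 0) :
    psiR c d t c₁ (p 0) (p 1) (p 2) (p 3) (p 4)
      = ((entropyPart c d p - entropy ![p 0] : ℝ) : EReal)
        + rho c d t c₁ (p 0) (p 1) (p 2) (p 3) (p 4) := by
  unfold psiR entropyPart
  rw [entropy_chain h0 (by linarith [hp.delta_le, hp.delta_nonneg]) hp.delta_nonneg hp.delta_le]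
  congr 2
  ring

theorem le_psiR {p : Fin 5 → ℝ} (hp : FeasiblePt c d t c₁ p) (h0 : 0 < p 0) (r : ℝ)
    (h : ∀ x : Fin 4 → ℝ, (∀ i, 0 < x i) → r ≤ psiAt c d t c₁ x p - entropy ![p 0]) :
    (r : EReal) ≤ psiR c d t c₁ (p 0) (p 1) (p 2) (p 3) (p 4) := by
  rw [psiR_eq hp h0]
  refine le_coe_add_rho c d t c₁ _ r p fun x hx => (h x hx).trans (le_of_eq ?_)
  rw [psiAt]
  ring

theorem entropy_one_nonneg {a : ℝ} (h0 : 0 ≤ a) (h1 : a ≤ 1) : 0 ≤ entropy ![a] := by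
  rw [entropy_one]
  exact add_nonneg (Real.negMulLog_nonneg h0 h1)
    (Real.negMulLog_nonneg (by linarith) (by linarith))

/-! ### The feasible region -/

/-- The standing assumptions, in the form in which they are used. -/
structure Admissible (c d t c₁ : ℕ) : Prop where
  t_pos : 0 < t
  le_d : 2 * t + 1 ≤ d
  two_le : 2 ≤ c₁
  lt_c : c₁ < c
  gain : 1 < ((c : ℝ) - c₁ + 1) * ((t : ℝ) / (t + 1))

/-- If `c ≤ c₁`, the first factor of the gain would be at most `1` and the second is below `1`. The
resulting `c₁ < c` makes the natural subtraction `c - c₁` exact. -/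
theorem Admissible.of_gain (ht : 0 < t) (hd : 2 * t + 1 ≤ d) (hc₁ : 2 ≤ c₁)
    (hc : 1 < ((c : ℝ) - c₁ + 1) * ((t : ℝ) / (t + 1))) : Admissible c d t c₁ := by
  refine ⟨ht, hd, hc₁, ?_, hc⟩
  by_contra! h
  have h' : (c : ℝ) ≤ c₁ := by exact_mod_cast h
  have h1 : (t : ℝ) / (t + 1) < 1 := by rw [div_lt_one (by positivity)]; linarith
  have h2 : (0 : ℝ) ≤ (t : ℝ) / (t + 1) := by positivity
  nlinarith

namespace Admissible
variable (A : Admissible c d t c₁)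
include A

theorem c_pos : (0 : ℝ) < c := by exact_mod_cast (by have := A.lt_c; omega : 0 < c)
theorem d_pos : (0 : ℝ) < d := by exact_mod_cast (by have := A.le_d; omega : 0 < d)
theorem c₁_pos : (0 : ℝ) < c₁ := by exact_mod_cast (by have := A.two_le; omega : 0 < c₁)
theorem stay_pos : (0 : ℝ) < (c : ℝ) - c₁ + 1 := by
  have : (c₁ : ℝ) < c := by exact_mod_cast A.lt_c
  linarith
end Admissible

section
variable {p : Fin 5 → ℝ} (A : Admissible c d t c₁) (hp : FeasiblePt c d t c₁ p)
include A hp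

theorem FeasiblePt.zero_le_omega : 0 ≤ p 4 := by
  have := hp.omega_nonneg; have := A.c_pos
  by_contra! h
  nlinarith

theorem FeasiblePt.omega_le_min : p 4 ≤ min (p 0) (p 3) :=
  le_of_mul_le_mul_right hp.omega_le A.c_pos

theorem FeasiblePt.omega_le_alpha : p 4 ≤ p 0 := (hp.omega_le_min A).trans (min_le_left _ _)

theorem FeasiblePt.omega_le_phi : p 4 ≤ p 3 := (hp.omega_le_min A).trans (min_le_right _ _)

theorem FeasiblePt.edges_le' : p 0 - p 4 ≤ 1 - p 3 :=
  le_of_mul_le_mul_right hp.edges_le A.c_pos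

theorem FeasiblePt.mem_Icc : p ∈ Set.Icc (0 : Fin 5 → ℝ) 1 := by
  have h1 := hp.zero_le_omega A
  have h2 := hp.omega_le_alpha A
  have h3 := hp.omega_le_phi A
  have h4 := hp.edges_le' A
  have := hp.gamma_nonneg; have := hp.gamma_le; have := hp.delta_nonneg; have := hp.delta_le
  constructor <;> intro i <;> fin_cases i <;> simp <;> linarith

end

theorem isClosed_setOf_feasiblePt (c d t c₁ : ℕ) : IsClosed {p | FeasiblePt c d t c₁ p} := by
  have : {p | FeasiblePt c d t c₁ p} = {p : Fin 5 → ℝ | 0 ≤ p 1 ∧ p 1 ≤ p 0 ∧ 0 ≤ p 2 ∧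
      p 2 ≤ 1 - p 0 ∧ 0 ≤ p 4 * c ∧ p 4 * c ≤ min (p 0) (p 3) * c ∧
      (p 0 - p 4) * c ≤ (1 - p 3) * c ∧ p 3 ≤ p 4 * d / (t + 1) ∧
      p 2 ≤ (p 3 - p 4) * c / c₁ ∧ p 1 ≤ p 4 * c / ((c : ℝ) - c₁ + 1)} := by
    ext p
    exact ⟨fun ⟨a, b, e, f, g, h, i, j, k, l⟩ => ⟨a, b, e, f, g, h, i, j, k, l⟩,
      fun ⟨a, b, e, f, g, h, i, j, k, l⟩ => ⟨a, b, e, f, g, h, i, j, k, l⟩⟩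
  rw [this]
  simp only [Set.ofPred_and]
  repeat' apply IsClosed.inter
  all_goals exact isClosed_le (by fun_prop) (by fun_prop)

theorem isCompact_setOf_feasiblePt (A : Admissible c d t c₁) :
    IsCompact {p | FeasiblePt c d t c₁ p} :=
  isCompact_Icc.of_isClosed_subset (isClosed_setOf_feasiblePt c d t c₁) fun _ hp => hp.mem_Icc A

theorem continuous_entropyPart (c d : ℕ) : Continuous (entropyPart c d) := by
  have := Real.continuous_negMulLog
  unfold entropyPart
  simp only [entropy_one, entropy_three]
  fun_prop

/-- With `x` frozen, the logarithms of the polynomials are constants and `negMulLog` is continuous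
at `0`. All compactness arguments use only this, never continuity of `psi` itself. -/
theorem continuous_psiAt (c d t c₁ : ℕ) (x : Fin 4 → ℝ) : Continuous (psiAt c d t c₁ x) := by
  have := continuous_entropyPart c d
  unfold psiAt rhoAt
  fun_prop

theorem continuous_entropy_one : Continuous fun a : ℝ => entropy ![a] := by
  have := Real.continuous_negMulLog
  simp only [entropy_one]
  fun_prop

/-! ### Estimates for the polynomials -/

theorem le_binomPoly {n a b j : ℕ} {x : ℝ} (hx : 0 ≤ x) (hj : j ∈ Finset.Icc a b) :
    (n.choose j : ℝ) * x ^ j ≤ binomPoly n a b x :=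
  Finset.single_le_sum (f := fun j => (n.choose j : ℝ) * x ^ j) (fun _ _ => by positivity) hj

theorem binomPoly_pos {n a b : ℕ} (hab : a ≤ b) (ha : a ≤ n) {x : ℝ} (hx : 0 < x) :
    0 < binomPoly n a b x :=
  lt_of_lt_of_le (mul_pos (by exact_mod_cast Nat.choose_pos ha) (pow_pos hx _))
    (le_binomPoly hx.le (Finset.mem_Icc.2 ⟨le_rfl, hab⟩))

theorem one_le_binomPoly (n b : ℕ) {x : ℝ} (hx : 0 ≤ x) : 1 ≤ binomPoly n 0 b x := by
  simpa using le_binomPoly (n := n) (b := b) (j := 0) hx (by simp)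

theorem binomPoly_le {n a b : ℕ} (hb : b ≤ n) {x : ℝ} (hx : 0 ≤ x) :
    binomPoly n a b x ≤ (1 + x) ^ n := by
  rw [add_comm, add_pow]
  refine (Finset.sum_le_sum_of_subset_of_nonneg (t := Finset.range (n + 1)) ?_ ?_).trans
    (le_of_eq (Finset.sum_congr rfl fun j _ => by simp [mul_comm]))
  · intro j hj
    simp only [Finset.mem_Icc, Finset.mem_range] at *
    omega
  · intros
    positivity

theorem binomPoly_le_pow {n a : ℕ} {x : ℝ} (hx : 0 ≤ x) (hx1 : x ≤ 1) :
    binomPoly n a n x ≤ x ^ a * 2 ^ n := by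
  have h : binomPoly n a n x ≤ x ^ a * binomPoly n a n 1 := by
    unfold binomPoly
    rw [Finset.mul_sum]
    refine Finset.sum_le_sum fun j hj => ?_
    rw [one_pow, mul_one, mul_comm]
    exact mul_le_mul_of_nonneg_right (pow_le_pow_of_le_one hx hx1 (Finset.mem_Icc.1 hj).1)
      (by positivity)
  refine h.trans (mul_le_mul_of_nonneg_left ?_ (by positivity))
  have := binomPoly_le (a := a) (le_refl n) (zero_le_one (α := ℝ))
  norm_num at this
  exact this

/-- Linear in `x` because `log (1 + x) ≤ x`. This matters for `F3` and `G1`, whose weights do not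
become small with `α`. -/
theorem log_binomPoly_le {n a b : ℕ} (hab : a ≤ b) (hb : b ≤ n) {x : ℝ} (hx : 0 < x) :
    Real.log (binomPoly n a b x) ≤ n * x := by
  refine (Real.log_le_log (binomPoly_pos hab (hab.trans hb) hx) (binomPoly_le hb hx.le)).trans ?_
  rw [Real.log_pow]
  refine mul_le_mul_of_nonneg_left ?_ (by positivity)
  have := Real.log_le_sub_one_of_pos (show 0 < 1 + x by linarith)
  linarith

/-- For `x ≤ 1` the lowest power `x ^ a` dominates, and the coefficients sum to at most `2 ^ n`. -/
theorem log_binomPoly_le_log {n a : ℕ} (ha : a ≤ n) {x : ℝ} (hx : 0 < x) (hx1 : x ≤ 1) :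
    Real.log (binomPoly n a n x) ≤ a * Real.log x + n := by
  refine (Real.log_le_log (binomPoly_pos ha ha hx) (binomPoly_le_pow hx.le hx1)).trans ?_
  rw [Real.log_mul (by positivity) (by positivity), Real.log_pow, Real.log_pow]
  have : Real.log 2 ≤ 1 := by linarith [Real.log_two_lt_d9]
  have := mul_le_mul_of_nonneg_left this (Nat.cast_nonneg (α := ℝ) n)
  linarith

theorem F0_pos (A : Admissible c d t c₁) {x : ℝ} (hx : 0 < x) : 0 < F0 c c₁ x :=
  have := A.lt_c; have := A.two_le
  binomPoly_pos (by omega) (by omega) hx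

theorem F1_pos {x : ℝ} (hx : 0 < x) : 0 < F1 c c₁ x := binomPoly_pos (by omega) (by omega) hx

theorem F2_pos (A : Admissible c d t c₁) {x : ℝ} (hx : 0 < x) : 0 < F2 c c₁ x :=
  binomPoly_pos A.lt_c.le A.lt_c.le hx

theorem F3_pos {x : ℝ} (hx : 0 < x) : 0 < F3 c c₁ x := binomPoly_pos (by omega) (by omega) hx

theorem G0_pos (A : Admissible c d t c₁) {x : ℝ} (hx : 0 < x) : 0 < G0 d t x :=
  have := A.le_d
  binomPoly_pos (by omega) (by omega) hx

theorem G1_pos {x : ℝ} (hx : 0 < x) : 0 < G1 d t x := binomPoly_pos (by omega) (by omega) hx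

end

end GLDPC

namespace GLDPC

noncomputable section

variable {c d t c₁ : ℕ}

/-! ### The exponent for small error fractions -/

/-- Rescaling `y` by `a` extracts the main term `-y log a`; the rest is `a * negMulLog (y / a) ≤ a`.
-/
theorem negMulLog_le_add {a y : ℝ} (ha : 0 < a) (hy : 0 ≤ y) :
    Real.negMulLog y ≤ -(y * Real.log a) + a := by
  have h := negMulLog_div (y := y) ha
  have h2 := Real.negMulLog_le_one_sub_self (div_nonneg hy ha.le)
  have h3 : 0 ≤ y / a := by positivity
  nlinarith

theorem le_negMulLog_of_le {a y D : ℝ} (ha : 0 < a) (hy : 0 ≤ y) (hyD : y ≤ D * a) :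
    -(y * Real.log a) - D ^ 2 * a ≤ Real.negMulLog y := by
  rcases hy.eq_or_lt with rfl | hy'
  · simp; positivity
  · have h := negMulLog_div (y := y) ha
    have h0 : 0 < y / a := by positivity
    have h1 : y / a ≤ D := by rwa [div_le_iff₀ ha]
    have h2 := Real.log_le_sub_one_of_pos h0
    have h3 : -(D ^ 2) ≤ Real.negMulLog (y / a) := by
      simp only [Real.negMulLog]
      nlinarith
    nlinarith

section
variable {p : Fin 5 → ℝ}

theorem FeasiblePt.phi_edges_le (A : Admissible c d t c₁) (hp : FeasiblePt c d t c₁ p) :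
    p 3 * c / d * (t + 1) ≤ p 4 * c := by
  have h := hp.phi_le
  have hd := A.d_pos
  have hc := A.c_pos
  rw [le_div_iff₀ (by positivity)] at h
  rw [div_mul_eq_mul_div, div_le_iff₀ hd]
  nlinarith

/-- Together with `delta_le_mul` this makes all coordinates `O(α)`, so that the errors in the
expansion at `α = 0` are `O(α)`. -/
theorem FeasiblePt.phi_le_mul (A : Admissible c d t c₁) (hp : FeasiblePt c d t c₁ p) :
    p 3 ≤ d * p 0 := by
  have h := hp.phi_le
  have h1 := hp.omega_le_alpha A
  have h0 := hp.zero_le_omega A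
  have ht : (0 : ℝ) ≤ t := t.cast_nonneg
  refine h.trans ((div_le_self (by have := A.d_pos; positivity) (by linarith)).trans ?_)
  have := mul_le_mul_of_nonneg_right h1 A.d_pos.le
  linarith

theorem FeasiblePt.delta_le_mul (A : Admissible c d t c₁) (hp : FeasiblePt c d t c₁ p) :
    p 2 ≤ c * d * p 0 := by
  have h := hp.delta_le'
  have h1 := hp.phi_le_mul A
  have h0 := hp.zero_le_omega A
  have hc := A.c_pos
  have h2 := hp.omega_le_phi A
  have h3 : (1 : ℝ) ≤ c₁ := by exact_mod_cast (by have := A.two_le; omega : 1 ≤ c₁)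
  refine h.trans ((div_le_self (mul_nonneg (by linarith) hc.le) h3).trans ?_)
  nlinarith

/-- The coefficient of `-log α` in the exponent is negative. -/
theorem exists_gain (A : Admissible c d t c₁) : ∃ κ : ℝ, 0 < κ ∧
    ∀ p : Fin 5 → ℝ, FeasiblePt c d t c₁ p → p 0 - p 1 ≤ p 2 →
      p 0 + p 2 - c₁ * p 2 + p 3 * c / d - p 4 * c ≤ -(κ * p 0) := by
  set τ : ℝ := (t : ℝ) / (t + 1) with hτ
  set K : ℝ := ((c : ℝ) - c₁ + 1) * τ with hK
  have hK1 : 1 < K := A.gain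
  have ht : (0 : ℝ) < t := by exact_mod_cast A.t_pos
  have hτ0 : 0 < τ := by positivity
  have hd := A.d_pos
  have hc := A.c_pos
  have hc₁ := A.c₁_pos
  have hs := A.stay_pos
  set q : ℝ := c₁ * t / d with hq
  have hq0 : 0 < q := by positivity
  -- The quantity `W τ` dominates both `K γ` and `q δ`. A share `θ` of it pays for `δ`; `θ` is
  -- chosen so that `(1 - θ) K = 1 + (K - 1) / 2`, and the other share still pays for `γ` with a
  -- margin.
  set θ : ℝ := (K - 1) / (2 * K) with hθ
  have hθ0 : 0 < θ := div_pos (by linarith) (by linarith)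
  have hθ1 : θ * K = (K - 1) / 2 := by rw [hθ]; field_simp
  have hθ2 : θ ≤ 1 := by
    rw [hθ, div_le_one (by linarith)]; linarith
  refine ⟨min ((K - 1) / 2) (θ * q), lt_min (by linarith) (by positivity), fun p hp hlow => ?_⟩
  set κ := min ((K - 1) / 2) (θ * q)
  have hκ1 : κ ≤ (K - 1) / 2 := min_le_left _ _
  have hκ2 : κ ≤ θ * q := min_le_right _ _
  have hκ0 : 0 < κ := lt_min (by linarith) (by positivity)
  have hB := hp.phi_edges_le A
  set W : ℝ := p 4 * c with hW
  set B : ℝ := p 3 * c / d with hBd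
  have hW0 : 0 ≤ W := hp.omega_nonneg
  have hWτ : τ * (t + 1) = t := by rw [hτ]; field_simp
  -- Each bad check absorbs at least `t + 1` error edges, so `B ≤ W / (t + 1) = W (1 - τ)`.
  have hBW : B - W ≤ -(W * τ) := by
    have h2 : B * (t + 1) ≤ (W - W * τ) * (t + 1) := by
      have : (W - W * τ) * (t + 1) = W := by linear_combination -W * hWτ
      rw [this]; exact hB
    have := le_of_mul_le_mul_right h2 (by positivity)
    linarith
  have hγ : K * p 1 ≤ W * τ := by
    have h := hp.gamma_le'
    rw [le_div_iff₀ hs] at h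
    have := mul_le_mul_of_nonneg_right h hτ0.le
    rw [hK]; linarith
  have hδ : q * p 2 ≤ W * τ := by
    have h := hp.delta_le'
    rw [le_div_iff₀ hc₁] at h
    have h1 : p 2 * c₁ ≤ B * d := by
      have h3 : B * d = p 3 * c := by rw [hBd]; field_simp
      have h4 := mul_nonneg (hp.zero_le_omega A) hc.le
      linarith
    have h2 : q * p 2 * (t + 1) ≤ W * τ * (t + 1) := by
      have e1 : W * τ * (t + 1) = W * t := by linear_combination W * hWτ
      have e2 : q * p 2 = t * (p 2 * c₁) / d := by rw [hq]; ring
      rw [e1, e2, div_mul_eq_mul_div, div_le_iff₀ hd]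
      have h5 : t * (p 2 * c₁) * (t + 1) ≤ t * (B * d) * (t + 1) := by gcongr
      have h6 : t * d * (B * (t + 1)) ≤ t * d * W := by gcongr
      linarith
    exact le_of_mul_le_mul_right h2 (by positivity)
  -- From `α ≤ γ + δ` and `c₁ ≥ 2` one gets `α + δ - c₁ δ ≤ γ`.
  have h2le : (2 : ℝ) ≤ c₁ := by exact_mod_cast A.two_le
  have hδ0 := hp.delta_nonneg
  have hγ0 := hp.gamma_nonneg
  have m1 := mul_le_mul_of_nonneg_left hγ (sub_nonneg.2 hθ2)
  have m2 := mul_le_mul_of_nonneg_left hδ hθ0.le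
  have m3 := mul_le_mul_of_nonneg_right hκ1 hγ0
  have m4 := mul_le_mul_of_nonneg_right hκ2 hδ0
  have m5 := mul_le_mul_of_nonneg_right h2le hδ0
  have m6 : κ * p 0 ≤ κ * (p 1 + p 2) := mul_le_mul_of_nonneg_left (by linarith) hκ0.le
  have m7 : (1 - θ) * (K * p 1) = p 1 + (K - 1) / 2 * p 1 := by linear_combination -p 1 * hθ1
  linarith

/-- Every entropy argument `y = O(α)` contributes `-y log α + O(α)`, while the complementary
arguments near `1` contribute `O(α)`. The socket entropy enters negatively and therefore needs the
lower bound `le_negMulLog_of_le`. -/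
theorem entropyPart_le (A : Admissible c d t c₁) : ∃ C : ℝ, 0 ≤ C ∧
    ∀ p : Fin 5 → ℝ, FeasiblePt c d t c₁ p → 0 < p 0 →
      entropyPart c d p ≤ -((p 0 + p 2 + p 3 * c / d - c * (p 0 + p 3 - p 4)) * Real.log (p 0))
        + C * p 0 := by
  have hc := A.c_pos
  have hd := A.d_pos
  refine ⟨3 + 1 + c * d + c / d * (1 + d) + c * (2 + d ^ 2), by positivity,
    fun p hp h0 => ?_⟩
  have b0 := hp.zero_le_omega A
  have b1 := hp.omega_le_alpha A
  have b2 := hp.omega_le_phi A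
  have b3 := hp.edges_le' A
  have b4 := hp.phi_le_mul A
  have b5 := hp.delta_le_mul A
  have b6 := hp.gamma_nonneg; have b7 := hp.gamma_le; have b8 := hp.delta_nonneg
  have b9 := hp.delta_le
  unfold entropyPart
  rw [entropy_three, entropy_one, entropy_three]
  have e1 := negMulLog_le_add h0 b6
  have e2 := negMulLog_le_add h0 (show 0 ≤ p 0 - p 1 by linarith)
  have e3 := negMulLog_le_add h0 b8
  have e4 := Real.negMulLog_le_one_sub_self (show 0 ≤ 1 - (p 1 + (p 0 - p 1) + p 2) by linarith)
  have e5 := negMulLog_le_add h0 (show 0 ≤ p 3 by linarith)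
  have e6 := Real.negMulLog_le_one_sub_self (show 0 ≤ 1 - p 3 by linarith)
  have e7 := le_negMulLog_of_le (D := 1) h0 b0 (by linarith)
  have e8 := le_negMulLog_of_le (D := 1) h0 (show 0 ≤ p 0 - p 4 by linarith) (by linarith)
  have e9 := le_negMulLog_of_le (D := d) h0 (show 0 ≤ p 3 - p 4 by linarith) (by linarith)
  have e10 := Real.negMulLog_nonneg (show 0 ≤ 1 - (p 4 + (p 0 - p 4) + (p 3 - p 4)) by linarith)
    (by linarith)
  have f1 : (c : ℝ) / d * (Real.negMulLog (p 3) + Real.negMulLog (1 - p 3))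
      ≤ c / d * (-(p 3 * Real.log (p 0)) + (1 + d) * p 0) :=
    mul_le_mul_of_nonneg_left (by linarith) (by positivity)
  have f2 : c * (-((p 0 + p 3 - p 4) * Real.log (p 0)) - (2 + (d : ℝ) ^ 2) * p 0) ≤
      c * (Real.negMulLog (p 4) + Real.negMulLog (p 0 - p 4) + Real.negMulLog (p 3 - p 4)
        + Real.negMulLog (1 - (p 4 + (p 0 - p 4) + (p 3 - p 4)))) :=
    mul_le_mul_of_nonneg_left (by linarith) (by positivity)
  have f3 : (c : ℝ) / d * (-(p 3 * Real.log (p 0)) + (1 + d) * p 0)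
      = -(p 3 * c / d * Real.log (p 0)) + c / d * (1 + d) * p 0 := by ring
  linarith

/-- The multipliers are `1` where the polynomials carry weights `O(α)`. They are `α` in the second
and fourth infimum, where `F3` and `G1` carry weights of order one and their logarithms must be
`O(α)`; there `F2` yields the helpful term `c₁ δ log α`. -/
theorem rhoAt_le (A : Admissible c d t c₁) : ∃ C : ℝ, 0 ≤ C ∧
    ∀ p : Fin 5 → ℝ, FeasiblePt c d t c₁ p → 0 < p 0 →
      rhoAt c d t c₁ ![1, p 0, 1, p 0] p
        ≤ (c₁ * p 2 - (p 3 - p 4) * c - (p 0 - p 4) * c) * Real.log (p 0) + C * p 0 := by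
  have hc := A.c_pos
  have hd := A.d_pos
  refine ⟨c + (c * d * c + c) + c * d + c, by positivity, fun p hp h0 => ?_⟩
  have b0 := hp.zero_le_omega A
  have b1 := hp.omega_le_alpha A
  have b2 := hp.omega_le_phi A
  have b3 := hp.edges_le' A
  have b4 := hp.phi_le_mul A
  have b5 := hp.delta_le_mul A
  have b6 := hp.gamma_nonneg; have b7 := hp.gamma_le; have b8 := hp.delta_nonneg
  have b9 := hp.delta_le
  have h1 : p 0 ≤ 1 := by linarith
  have i1 := A.lt_c; have i2 := A.two_le; have i3 := A.le_d
  have l0 : Real.log (F0 c c₁ 1) ≤ c * 1 := log_binomPoly_le (by omega) le_rfl one_pos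
  have l1 : Real.log (F1 c c₁ 1) ≤ c * 1 := log_binomPoly_le (by omega) (by omega) one_pos
  have l2 : Real.log (F2 c c₁ (p 0)) ≤ c₁ * Real.log (p 0) + c :=
    log_binomPoly_le_log (by omega) h0 h1
  have l3 : Real.log (F3 c c₁ (p 0)) ≤ c * p 0 := log_binomPoly_le (by omega) (by omega) h0
  have l4 : Real.log (G0 d t 1) ≤ d * 1 := log_binomPoly_le (by omega) le_rfl one_pos
  have l5 : Real.log (G1 d t (p 0)) ≤ d * p 0 := log_binomPoly_le (by omega) (by omega) h0
  have m0 := mul_le_mul_of_nonneg_left l0 b6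
  have m1 := mul_le_mul_of_nonneg_left l1 (show 0 ≤ p 0 - p 1 by linarith)
  have m2 := mul_le_mul_of_nonneg_left l2 b8
  have m3 := mul_le_mul_of_nonneg_left l3 (show 0 ≤ 1 - p 0 - p 2 by linarith)
  have m3' : (1 - p 0 - p 2) * (c * p 0) ≤ 1 * (c * p 0) :=
    mul_le_mul_of_nonneg_right (by linarith) (by positivity)
  have m4 := mul_le_mul_of_nonneg_left l4
    (show 0 ≤ p 3 * c / d from div_nonneg (mul_nonneg (by linarith) hc.le) hd.le)
  have m5 := mul_le_mul_of_nonneg_left l5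
    (show 0 ≤ (1 - p 3) * c / d from div_nonneg (mul_nonneg (by linarith) hc.le) hd.le)
  have n4 : p 3 * c / d * (d * 1) = p 3 * c := by field_simp
  have n5 : (1 - p 3) * c / d * (d * p 0) = c * p 0 - p 3 * (c * p 0) := by field_simp
  have n6 : 0 ≤ p 3 * (c * p 0) := mul_nonneg (by linarith) (by positivity)
  have n7 := mul_le_mul_of_nonneg_right b4 hc.le
  have n8 := mul_le_mul_of_nonneg_right b5 hc.le
  simp only [rhoAt, Matrix.cons_val_zero, Matrix.cons_val_one, Matrix.cons_val, Real.log_one]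
  linarith

/-- For small `α` the exponent is at most `κ α log α + C α`. -/
theorem exists_psiAt_le (A : Admissible c d t c₁) : ∃ κ C : ℝ, 0 < κ ∧ 0 ≤ C ∧
    ∀ p : Fin 5 → ℝ, FeasiblePt c d t c₁ p → 0 < p 0 → p 0 - p 1 ≤ p 2 →
      psiAt c d t c₁ ![1, p 0, 1, p 0] p ≤ κ * p 0 * Real.log (p 0) + C * p 0 := by
  obtain ⟨κ, hκ, h1⟩ := exists_gain A
  obtain ⟨C, hC, h2⟩ := entropyPart_le A
  obtain ⟨D, hD, h3⟩ := rhoAt_le A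
  refine ⟨κ, C + D, hκ, by positivity, fun p hp h0 hs => ?_⟩
  have g1 := h1 p hp hs
  have g2 := h2 p hp h0
  have g3 := h3 p hp h0
  have hl : Real.log (p 0) ≤ 0 :=
    Real.log_nonpos h0.le (by linarith [hp.delta_nonneg, hp.delta_le])
  -- In the sum of the two estimates the terms `c α` and `c φ` cancel, and `-log α` is left with
  -- exactly the coefficient bounded in `exists_gain`.
  have g4 := mul_le_mul_of_nonpos_right g1 hl
  unfold psiAt
  linarith

end

end

end GLDPC

namespace GLDPC

noncomputable section

variable {c d t c₁ : ℕ} {p : Fin 5 → ℝ}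

/-! ### Scaling towards the origin -/

/-- The region is star-shaped about `0`: all constraints are homogeneous except those with a
constant `1` on the larger side. -/
theorem FeasiblePt.smul (hp : FeasiblePt c d t c₁ p) {s : ℝ} (h0 : 0 ≤ s) (h1 : s ≤ 1) :
    FeasiblePt c d t c₁ (s • p) := by
  have q1 := hp.gamma_nonneg
  have q2 := mul_le_mul_of_nonneg_left hp.gamma_le h0
  have q3 := hp.delta_nonneg
  have q4 := mul_le_mul_of_nonneg_left hp.delta_le h0
  have q5 := hp.omega_nonneg
  have q6 := mul_le_mul_of_nonneg_left hp.omega_le h0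
  have q7 := mul_le_mul_of_nonneg_left hp.edges_le h0
  have q8 := mul_le_mul_of_nonneg_left hp.phi_le h0
  have q9 := mul_le_mul_of_nonneg_left hp.delta_le' h0
  have q10 := mul_le_mul_of_nonneg_left hp.gamma_le' h0
  have hc : (0 : ℝ) ≤ c := c.cast_nonneg
  constructor <;> simp only [Pi.smul_apply, smul_eq_mul]
  · positivity
  · exact q2
  · positivity
  · linarith
  · rw [mul_assoc]; positivity
  · rw [← mul_min_of_nonneg _ _ h0]; linarith
  · nlinarith
  · exact q8.trans (le_of_eq (by ring))
  · exact q9.trans (le_of_eq (by ring))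
  · exact q10.trans (le_of_eq (by ring))

theorem mul_negMulLog_le {s y : ℝ} (h0 : 0 ≤ s) (h1 : s ≤ 1) (hy : 0 ≤ y) :
    s * Real.negMulLog y ≤ Real.negMulLog (s * y) := by
  rw [Real.negMulLog_mul]
  have := mul_nonneg hy (Real.negMulLog_nonneg h0 h1)
  linarith

/-- Concavity of `negMulLog` between `1 - y` and its zero at `1`. -/
theorem mul_negMulLog_one_sub_le {s y : ℝ} (h0 : 0 ≤ s) (h1 : s ≤ 1) (hy : y ≤ 1) :
    s * Real.negMulLog (1 - y) ≤ Real.negMulLog (1 - s * y) := by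
  have h := Real.concaveOn_negMulLog.2 (show (1 - y) ∈ Set.Ici (0 : ℝ) by simp [hy])
    (show (1 : ℝ) ∈ Set.Ici (0 : ℝ) by simp) h0 (sub_nonneg.2 h1) (by ring)
  simp only [smul_eq_mul, Real.negMulLog_one, mul_zero, add_zero] at h
  refine h.trans (le_of_eq ?_)
  congr 1
  ring

theorem mul_entropy_one_le {s a : ℝ} (h0 : 0 ≤ s) (h1 : s ≤ 1) (ha : 0 ≤ a) (ha1 : a ≤ 1) :
    s * entropy ![a] ≤ entropy ![s * a] := by
  rw [entropy_one, entropy_one]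
  have := mul_negMulLog_le h0 h1 ha
  have := mul_negMulLog_one_sub_le h0 h1 ha1
  linarith

theorem mul_entropy_three_le {s a b e : ℝ} (h0 : 0 ≤ s) (h1 : s ≤ 1) (ha : 0 ≤ a) (hb : 0 ≤ b)
    (he : 0 ≤ e) (hs : a + b + e ≤ 1) :
    s * entropy ![a, b, e] ≤ entropy ![s * a, s * b, s * e] := by
  rw [entropy_three, entropy_three]
  have := mul_negMulLog_le h0 h1 ha
  have := mul_negMulLog_le h0 h1 hb
  have := mul_negMulLog_le h0 h1 he
  have h := mul_negMulLog_one_sub_le h0 h1 hs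
  have e1 : s * a + s * b + s * e = s * (a + b + e) := by ring
  rw [e1]
  linarith

/-- The socket entropy, the only convex term of `psiAt`. -/
def socketEntropy (p : Fin 5 → ℝ) : ℝ := entropy ![p 4, p 0 - p 4, p 3 - p 4]

theorem continuous_socketEntropy : Continuous socketEntropy := by
  have := Real.continuous_negMulLog
  unfold socketEntropy
  simp only [entropy_three]
  fun_prop

/-- The first two entropies satisfy `s h(y) ≤ h(s y)`, and `rhoAt` is affine in `p` with constant
terms `log F3` and `(c/d) log G1`, both nonnegative. Only the socket entropy may have the wrong
sign; its defect does not involve `x`, so the estimate survives the infimum. -/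
theorem psiAt_smul_ge (A : Admissible c d t c₁) (hp : FeasiblePt c d t c₁ p) {s : ℝ}
    (h0 : 0 ≤ s) (h1 : s ≤ 1) {x : Fin 4 → ℝ} (hx : ∀ i, 0 < x i) :
    s * psiAt c d t c₁ x p + c * (s * socketEntropy p - socketEntropy (s • p))
      ≤ psiAt c d t c₁ x (s • p) := by
  have b0 := hp.zero_le_omega A
  have b2 := hp.omega_le_phi A
  have b3 := hp.edges_le' A
  have b1 := hp.omega_le_alpha A
  have b6 := hp.gamma_nonneg; have b7 := hp.gamma_le; have b8 := hp.delta_nonneg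
  have b9 := hp.delta_le
  have hc := A.c_pos
  have hd := A.d_pos
  have e1 := mul_entropy_three_le h0 h1 b6 (sub_nonneg.2 b7) b8 (by linarith)
  have e2 := mul_entropy_one_le h0 h1 (show 0 ≤ p 3 by linarith) (by linarith)
  have e3 := mul_le_mul_of_nonneg_left e2 (show (0 : ℝ) ≤ c / d by positivity)
  have l1 : 0 ≤ Real.log (F3 c c₁ (x 1)) := Real.log_nonneg (one_le_binomPoly _ _ (hx 1).le)
  have l2 : 0 ≤ Real.log (G1 d t (x 3)) := Real.log_nonneg (one_le_binomPoly _ _ (hx 3).le)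
  have l3 : 0 ≤ (1 - s) * Real.log (F3 c c₁ (x 1)) := mul_nonneg (by linarith) l1
  have l4 : 0 ≤ (1 - s) * (c / d * Real.log (G1 d t (x 3))) :=
    mul_nonneg (by linarith) (by positivity)
  have key : rhoAt c d t c₁ x (s • p) = s * rhoAt c d t c₁ x p
      + (1 - s) * Real.log (F3 c c₁ (x 1)) + (1 - s) * (c / d * Real.log (G1 d t (x 3))) := by
    simp only [rhoAt, Pi.smul_apply, smul_eq_mul]
    ring
  unfold psiAt entropyPart socketEntropy
  rw [key]
  simp only [Pi.smul_apply, smul_eq_mul]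
  rw [mul_sub] at e1
  linarith

/-! ### Compactness -/

/-- Otherwise the points of `Z n` with all `G x p ≥ -1/(n+1)` form nonempty nested compact sets, and
a common point has `G x p ≥ 0` for every `x ∈ S`. The sets `Z n` may shrink along with the
tolerance, as `exists_first_step_bound` requires. -/
theorem exists_le_neg_of_nested {X P : Type*} [TopologicalSpace P] {G : X → P → ℝ}
    (hG : ∀ x, Continuous (G x)) {S : Set X} {Z : ℕ → Set P} (hZ : Antitone Z)
    (hc : IsCompact (Z 0)) (hcl : ∀ n, IsClosed (Z n))
    (h : ∀ p, (∀ n, p ∈ Z n) → ∃ x ∈ S, G x p < 0) :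
    ∃ n : ℕ, ∀ p ∈ Z n, ∃ x ∈ S, G x p ≤ -(1 / ((n : ℝ) + 1)) := by
  by_contra! hcon
  let T : ℕ → Set P := fun n => Z n ∩ ⋂ x ∈ S, {p | -(1 / ((n : ℝ) + 1)) ≤ G x p}
  have hTcl : ∀ n, IsClosed (T n) := fun n => (hcl n).inter
    (isClosed_biInter fun x _ => isClosed_le continuous_const (hG x))
  obtain ⟨p, hp⟩ := IsCompact.nonempty_iInter_of_sequence_nonempty_isCompact_isClosed T
    (fun n => by
      rintro p ⟨hpZ, hpG⟩
      refine ⟨hZ n.le_succ hpZ, ?_⟩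
      simp only [Set.mem_iInter, Set.mem_ofPred_eq] at hpG ⊢
      intro x hx
      refine le_trans ?_ (hpG x hx)
      rw [neg_le_neg_iff]
      exact one_div_le_one_div_of_le (by positivity) (by push_cast; linarith))
    (fun n => by
      obtain ⟨p, hpZ, hpG⟩ := hcon n
      exact ⟨p, hpZ, by simpa using fun x hx => (hpG x hx).le⟩)
    (hc.of_isClosed_subset (hTcl 0) Set.inter_subset_left) hTcl
  rw [Set.mem_iInter] at hp
  obtain ⟨x, hx, hneg⟩ := h p fun n => (hp n).1
  have h2 : ∀ n : ℕ, -(1 / ((n : ℝ) + 1)) ≤ G x p := fun n => by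
    have := (hp n).2
    simp only [Set.mem_iInter] at this
    exact this x hx
  have h3 : Tendsto (fun n : ℕ => -(1 / ((n : ℝ) + 1))) atTop (𝓝 (-0)) :=
    tendsto_one_div_add_atTop_nhds_zero_nat.neg
  have := le_of_tendsto h3 (Eventually.of_forall h2)
  linarith

theorem exists_le_neg_of_isCompact {X P : Type*} [TopologicalSpace P] {G : X → P → ℝ}
    (hG : ∀ x, Continuous (G x)) {S : Set X} {Z : Set P} (hc : IsCompact Z) (hcl : IsClosed Z)
    (h : ∀ p ∈ Z, ∃ x ∈ S, G x p < 0) : ∃ η : ℝ, 0 < η ∧ ∀ p ∈ Z, ∃ x ∈ S, G x p ≤ -η := by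
  obtain ⟨n, hn⟩ := exists_le_neg_of_nested hG (Z := fun _ => Z) (fun _ _ _ => le_rfl) hc
    (fun _ => hcl) fun p hp => h p (hp 0)
  exact ⟨_, by positivity, hn⟩

/-! ### The thresholds -/

/-- The admissible multipliers `x` in `psiAt`. -/
def posSet : Set (Fin 4 → ℝ) := {x | ∀ i, 0 < x i}

theorem f_le {α r : ℝ} (h : ∀ p, FeasiblePt c d t c₁ p → p 0 = α → p 0 - p 1 ≤ p 2 →
    ∃ x ∈ posSet, psiAt c d t c₁ x p ≤ r) : f c d t c₁ α ≤ r := by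
  refine sSup_le ?_
  rintro _ ⟨γ, δ, φ, ω, hp, hs, rfl⟩
  obtain ⟨x, hx, hr⟩ := h ![α, γ, δ, φ, ω] hp rfl hs
  exact (psi_le c d t c₁ ![α, γ, δ, φ, ω] hx).trans (EReal.coe_le_coe_iff.2 hr)

theorem le_f {r : ℝ} (hp : FeasiblePt c d t c₁ p) (hs : p 0 - p 1 ≤ p 2)
    (h : ∀ x ∈ posSet, r ≤ psiAt c d t c₁ x p) : (r : EReal) ≤ f c d t c₁ (p 0) :=
  (le_psi c d t c₁ p r h).trans (le_sSup ⟨p 1, p 2, p 3, p 4, hp, hs, rfl⟩)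

theorem le_fR {r ν : ℝ} (hp : FeasiblePt c d t c₁ p) (h0 : 0 < p 0) (hs : ν ≤ p 1 + p 2)
    (h : ∀ x ∈ posSet, r ≤ psiAt c d t c₁ x p - entropy ![p 0]) :
    (r : EReal) ≤ fR c d t c₁ (p 0) ν :=
  (le_psiR hp h0 r h).trans (le_sSup ⟨p 1, p 2, p 3, p 4, hp, hs, rfl⟩)

theorem exists_psiAt_neg (hp : FeasiblePt c d t c₁ p) (hs : p 0 - p 1 ≤ p 2)
    (h : f c d t c₁ (p 0) < 0) : ∃ x ∈ posSet, psiAt c d t c₁ x p < 0 := by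
  by_contra! hcon
  exact absurd (le_f hp hs hcon) (not_le.2 (by exact_mod_cast h))

/-- For `α ≤ ν` the constraint `γ + δ ≥ ν` is the stronger one, and `psiR` is `psi` minus a
nonnegative entropy. -/
theorem fR_le_f {α ν : ℝ} (h0 : 0 < α) (hν : α ≤ ν) : fR c d t c₁ α ν ≤ f c d t c₁ α := by
  refine sSup_le ?_
  rintro _ ⟨γ, δ, φ, ω, hp, hs, rfl⟩
  refine le_trans ?_ (le_sSup ⟨γ, δ, φ, ω, hp, by linarith, rfl⟩)
  have hp' : FeasiblePt c d t c₁ ![α, γ, δ, φ, ω] := hp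
  have h := psiR_eq hp' h0
  have hent := entropy_one_nonneg h0.le (show α ≤ 1 by linarith [hp.delta_le, hp.delta_nonneg])
  refine (le_of_eq h).trans (add_le_add (EReal.coe_le_coe_iff.2 ?_) le_rfl)
  change entropyPart c d ![α, γ, δ, φ, ω] - entropy ![α] ≤ entropyPart c d ![α, γ, δ, φ, ω]
  linarith

/-- All variables are corrupt, and all of them stay so. -/
theorem feasiblePt_all (A : Admissible c d t c₁) : FeasiblePt c d t c₁ ![1, 1, 0, 1, 1] := by
  have hc := A.c_pos
  have hs := A.stay_pos
  have h1 : (1 : ℝ) ≤ c₁ := by exact_mod_cast (by have := A.two_le; omega : 1 ≤ c₁)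
  have h2 : (t : ℝ) + 1 ≤ d := by exact_mod_cast (by have := A.le_d; omega : t + 1 ≤ d)
  constructor <;> simp
  · rw [le_div_iff₀ (by positivity)]; linarith
  · rw [le_div_iff₀ hs]; linarith

/-- All entropies vanish at this point, and the top terms `x ^ c` of `F0` and `x ^ d` of `G0`
already outweigh the monomials divided out. -/
theorem psiAt_all_nonneg (A : Admissible c d t c₁) {x : Fin 4 → ℝ} (hx : x ∈ posSet) :
    0 ≤ psiAt c d t c₁ x ![1, 1, 0, 1, 1] := by
  have hc := A.c_pos
  have hd := A.d_pos
  have i1 := A.lt_c; have i2 := A.two_le; have i3 := A.le_d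
  have l0 : c * Real.log (x 0) ≤ Real.log (F0 c c₁ (x 0)) := by
    rw [← Real.log_pow]
    refine Real.log_le_log (pow_pos (hx 0) _) ?_
    simpa [F0] using le_binomPoly (n := c) (a := c - c₁ + 1) (b := c) (j := c) (hx 0).le
      (by simp; omega)
  have l1 : d * Real.log (x 2) ≤ Real.log (G0 d t (x 2)) := by
    rw [← Real.log_pow]
    refine Real.log_le_log (pow_pos (hx 2) _) ?_
    simpa [G0] using le_binomPoly (n := d) (a := t + 1) (b := d) (j := d) (hx 2).le
      (by simp; omega)
  have l2 := mul_le_mul_of_nonneg_left l1 (show (0 : ℝ) ≤ c / d by positivity)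
  have l3 : (c : ℝ) / d * (d * Real.log (x 2)) = c * Real.log (x 2) := by field_simp
  simp [psiAt, entropyPart, rhoAt, entropy_one, entropy_three]
  linarith

theorem exists_smallFraction (A : Admissible c d t c₁) : ∃ κ C ε : ℝ, 0 < κ ∧ 0 < ε ∧ ε ≤ 1 ∧
    (∀ a, 0 < a → a ≤ ε → κ * Real.log a + C ≤ -1) ∧
    ∀ p : Fin 5 → ℝ, FeasiblePt c d t c₁ p → 0 < p 0 → p 0 - p 1 ≤ p 2 →
      ∃ x ∈ posSet, psiAt c d t c₁ x p ≤ p 0 * (κ * Real.log (p 0) + C) := by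
  obtain ⟨κ, C, hκ, hC, h⟩ := exists_psiAt_le A
  -- This `ε` solves `κ log ε + C = -1`.
  refine ⟨κ, C, Real.exp (-((C + 1) / κ)), hκ, Real.exp_pos _,
    Real.exp_le_one_iff.2 (neg_nonpos.2 (by positivity)), fun a ha hε => ?_, fun p hp h0 hs => ?_⟩
  · have h1 := Real.log_le_log ha hε
    rw [Real.log_exp] at h1
    have h2 := mul_le_mul_of_nonneg_left h1 hκ.le
    have h3 : κ * -((C + 1) / κ) = -(C + 1) := by field_simp
    linarith
  · refine ⟨![1, p 0, 1, p 0], ?_, (h p hp h0 hs).trans (le_of_eq (by ring))⟩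
    intro i
    fin_cases i <;> simp [h0]

/-- The feasible points taking part in the maximization for `f(α)`, for `a ≤ α ≤ b`. -/
def growthSet (c d t c₁ : ℕ) (a b : ℝ) : Set (Fin 5 → ℝ) :=
  {p | FeasiblePt c d t c₁ p} ∩ {p | a ≤ p 0 ∧ p 0 ≤ b ∧ p 0 - p 1 ≤ p 2}

theorem isClosed_growthSet (a b : ℝ) : IsClosed (growthSet c d t c₁ a b) := by
  refine (isClosed_setOf_feasiblePt c d t c₁).inter ?_
  simp only [Set.ofPred_and]
  exact (isClosed_le (by fun_prop) (by fun_prop)).inter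
    ((isClosed_le (by fun_prop) (by fun_prop)).inter (isClosed_le (by fun_prop) (by fun_prop)))

theorem isCompact_growthSet (A : Admissible c d t c₁) (a b : ℝ) :
    IsCompact (growthSet c d t c₁ a b) :=
  (isCompact_setOf_feasiblePt A).of_isClosed_subset (isClosed_growthSet a b)
    Set.inter_subset_left

/-- A supremum of negative values could still be `0`; compactness of the slice supplies a uniform
gap. -/
theorem f_neg_of_forall (A : Admissible c d t c₁) {α : ℝ}
    (h : ∀ p ∈ growthSet c d t c₁ α α, ∃ x ∈ posSet, psiAt c d t c₁ x p < 0) :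
    f c d t c₁ α < 0 := by
  obtain ⟨η, hη, h'⟩ := exists_le_neg_of_isCompact (continuous_psiAt c d t c₁)
    (isCompact_growthSet A α α) (isClosed_growthSet α α) h
  refine (f_le (r := -η) fun p hp h0 hs => h' p ⟨hp, h0.ge, h0.le, hs⟩).trans_lt ?_
  exact_mod_cast neg_lt_zero.2 hη

/-- If `f` is positive somewhere, it is positive slightly further left. -/
theorem exists_f_pos_of_f_pos (A : Admissible c d t c₁) {α : ℝ} (h0 : 0 < α)
    (h : 0 < f c d t c₁ α) : ∃ β, 0 < β ∧ β < α ∧ 0 < f c d t c₁ β := by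
  obtain ⟨_, ⟨γ, δ, φ, ω, hp, hs, rfl⟩, hpos⟩ := lt_sSup_iff.1 h
  obtain ⟨r, hr0, hr⟩ := EReal.lt_iff_exists_real_btwn.1 hpos
  set p : Fin 5 → ℝ := ![α, γ, δ, φ, ω]
  have hp' : FeasiblePt c d t c₁ p := hp
  have hr0' : 0 < r := by exact_mod_cast hr0
  have hpr : ∀ x ∈ posSet, r ≤ psiAt c d t c₁ x p := fun x hx =>
    EReal.coe_le_coe_iff.1 (hr.le.trans (psi_le c d t c₁ p hx))
  -- A lower bound for `psiAt` at `s • p`, valid for all `x` and continuous in `s`, with value `r >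
  -- 0` at `s = 1`.
  let g : ℝ → ℝ := fun s => s * r + c * (s * socketEntropy p - socketEntropy (s • p))
  have hg : Continuous g := by
    have := continuous_socketEntropy
    fun_prop
  have hg1 : 0 < g 1 := by simpa [g] using hr0'
  have hev : ∀ᶠ s in 𝓝[<] (1 : ℝ), 0 < g s ∧ 0 < s ∧ s < 1 := by
    refine (((hg.tendsto 1).eventually_const_lt hg1).filter_mono nhdsWithin_le_nhds).and
      (((eventually_gt_nhds one_pos).filter_mono nhdsWithin_le_nhds).and
        (eventually_mem_nhdsWithin))
  obtain ⟨s, hgs, hs0, hs1⟩ := hev.exists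
  refine ⟨s * α, by positivity, by nlinarith, ?_⟩
  have : ((g s : ℝ) : EReal) ≤ f c d t c₁ ((s • p) 0) := by
    refine le_f (hp'.smul hs0.le hs1.le) ?_ fun x hx => ?_
    · have := mul_le_mul_of_nonneg_left hs hs0.le
      change s * α - s * γ ≤ s * δ
      linarith
    · have h1 := psiAt_smul_ge A hp' hs0.le hs1.le hx
      have h2 := mul_le_mul_of_nonneg_left (hpr x hx) hs0.le
      simp only [g]
      linarith
  exact lt_of_lt_of_le (by exact_mod_cast hgs) this

/-- The function `f` has a smallest positive root, and is negative to its left. -/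
theorem exists_isLeast_root (A : Admissible c d t c₁) : ∃ α₀ : ℝ,
    IsLeast {α : ℝ | 0 < α ∧ f c d t c₁ α = 0} α₀ ∧ α₀ ≤ 1 ∧
      ∀ α, 0 < α → α < α₀ → f c d t c₁ α < 0 := by
  obtain ⟨κ, C, ε, hκ, hε0, hε1, hε, hsmall⟩ := exists_smallFraction A
  -- The points with `psi ≥ 0`, written as an intersection of closed conditions. Restricting to `α ≥
  -- ε` loses nothing, since below `ε` the exponent is negative by `hsmall`; the minimal first
  -- coordinate on `T` will be `α₀`.
  let T : Set (Fin 5 → ℝ) :=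
    growthSet c d t c₁ ε 1 ∩ ⋂ x ∈ posSet, {p | 0 ≤ psiAt c d t c₁ x p}
  have hTcl : IsClosed T := (isClosed_growthSet ε 1).inter
    (isClosed_biInter fun x _ => isClosed_le continuous_const (continuous_psiAt c d t c₁ x))
  have hT : IsCompact T :=
    (isCompact_growthSet A ε 1).of_isClosed_subset hTcl Set.inter_subset_left
  have hmem : ∀ p, p ∈ T ↔ p ∈ growthSet c d t c₁ ε 1 ∧
      ∀ x ∈ posSet, 0 ≤ psiAt c d t c₁ x p := fun p => by
    simp [T]
  have hTne : T.Nonempty := ⟨![1, 1, 0, 1, 1], (hmem _).2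
    ⟨⟨feasiblePt_all A, by simpa using hε1⟩, fun x hx => psiAt_all_nonneg A hx⟩⟩
  obtain ⟨p, hpT, hpmin⟩ := hT.exists_isMinOn hTne
    (continuous_apply (0 : Fin 5)).continuousOn
  obtain ⟨⟨hpF, hpε, hp1, hps⟩, hpx⟩ := (hmem p).1 hpT
  have hp0 : 0 < p 0 := hε0.trans_le hpε
  have hneg : ∀ α, 0 < α → α < p 0 → f c d t c₁ α < 0 := by
    intro α h0 hlt
    refine f_neg_of_forall A fun q hq => ?_
    obtain ⟨hqF, hq1, hq2, hqs⟩ := hq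
    have hq0 : q 0 = α := le_antisymm hq2 hq1
    rcases lt_or_ge α ε with hαε | hαε
    · obtain ⟨x, hx, hle⟩ := hsmall q hqF (hq0 ▸ h0) hqs
      refine ⟨x, hx, hle.trans_lt ?_⟩
      have := hε (q 0) (hq0 ▸ h0) (hq0 ▸ hαε.le)
      exact mul_neg_of_pos_of_neg (hq0 ▸ h0) (by linarith)
    · by_contra! hcon
      have hqT : q ∈ T := (hmem q).2 ⟨⟨hqF, hq0 ▸ hαε, by linarith, hqs⟩, hcon⟩
      have := isMinOn_iff.1 hpmin q hqT
      linarith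
  refine ⟨p 0, ⟨⟨hp0, le_antisymm ?_ ?_⟩, ?_⟩, hp1, hneg⟩
  · by_contra! hcon
    obtain ⟨β, hβ0, hβ, hfβ⟩ := exists_f_pos_of_f_pos A hp0 hcon
    exact absurd hfβ (not_lt.2 (hneg β hβ0 hβ).le)
  · exact_mod_cast le_f hpF hps hpx
  · rintro β ⟨hβ0, hfβ⟩
    by_contra! hlt
    exact (hneg β hβ0 hlt).ne hfβ

/-- The condition on `a` only concerns `α` strictly below `a`, so it passes to the supremum. The set
contains `α₀` by `fR_le_f`, and `1` bounds it because at `α = 1` the totally corrupt point gives a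
nonnegative exponent. -/
theorem exists_isGreatest_threshold (A : Admissible c d t c₁) {α₀ : ℝ} (h0 : 0 < α₀)
    (h1 : α₀ ≤ 1) (hneg : ∀ α, 0 < α → α < α₀ → f c d t c₁ α < 0) : ∃ α_R : ℝ,
    IsGreatest {a : ℝ | 0 < a ∧ ∀ α : ℝ, 0 < α → α < a → fR c d t c₁ α α₀ < 0} α_R ∧
      α_R ≤ 1 := by
  set S := {a : ℝ | 0 < a ∧ ∀ α : ℝ, 0 < α → α < a → fR c d t c₁ α α₀ < 0}
  have hmem : α₀ ∈ S := ⟨h0, fun α hα hlt => (fR_le_f hα hlt.le).trans_lt (hneg α hα hlt)⟩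
  have hbd : ∀ a ∈ S, a ≤ 1 := by
    rintro a ⟨_, ha⟩
    by_contra! hlt
    refine absurd (ha 1 one_pos hlt) (not_lt.2 ?_)
    have := le_fR (r := 0) (ν := α₀) (feasiblePt_all A) (by simp) (by simpa using h1)
      fun x hx => by simpa [entropy_one] using psiAt_all_nonneg A hx
    exact_mod_cast this
  have hB : BddAbove S := ⟨1, hbd⟩
  refine ⟨sSup S, ⟨⟨h0.trans_le (le_csSup hB hmem), fun α hα hlt => ?_⟩,
    fun a ha => le_csSup hB ha⟩, csSup_le ⟨_, hmem⟩ hbd⟩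
  obtain ⟨a, ha, hαa⟩ := exists_lt_of_lt_csSup ⟨_, hmem⟩ hlt
  exact ha.2 α hα hαa

theorem exists_growth_bound (A : Admissible c d t c₁) {α₀ : ℝ}
    (hneg : ∀ α, 0 < α → α < α₀ → f c d t c₁ α < 0) {a b : ℝ} (ha : 0 < a) (hb : b < α₀) :
    ∃ η : ℝ, 0 < η ∧ ∀ p ∈ growthSet c d t c₁ a b,
      ∃ x ∈ posSet, psiAt c d t c₁ x p ≤ -η := by
  refine exists_le_neg_of_isCompact (continuous_psiAt c d t c₁)
    (isCompact_growthSet A a b) (isClosed_growthSet a b) ?_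
  rintro p ⟨hp, h1, h2, hs⟩
  exact exists_psiAt_neg hp hs (hneg _ (ha.trans_le h1) (h2.trans_lt hb))

/-- Slack is needed in both parameters: `⌊α N⌋ / N` only approximates `α`, and the first iteration
must end at a fraction strictly below `α₀`. -/
theorem exists_first_step_bound (A : Admissible c d t c₁) {α ν : ℝ} (h0 : 0 < α)
    (h : fR c d t c₁ α ν < 0) : ∃ η : ℝ, 0 < η ∧ ∀ p, FeasiblePt c d t c₁ p →
      |p 0 - α| ≤ η → ν - η ≤ p 1 + p 2 →
      ∃ x ∈ posSet, psiAt c d t c₁ x p - entropy ![p 0] ≤ -η := by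
  let Z : ℕ → Set (Fin 5 → ℝ) := fun n => {p | FeasiblePt c d t c₁ p} ∩
    ({p | |p 0 - α| ≤ 1 / ((n : ℝ) + 1)} ∩ {p | ν - 1 / ((n : ℝ) + 1) ≤ p 1 + p 2})
  have hcl : ∀ n, IsClosed (Z n) := fun n => (isClosed_setOf_feasiblePt c d t c₁).inter
    ((isClosed_le (by fun_prop) (by fun_prop)).inter (isClosed_le (by fun_prop) (by fun_prop)))
  have hZ : Antitone Z := by
    rintro m n hmn p ⟨hp, h1, h2⟩
    have : 1 / ((n : ℝ) + 1) ≤ 1 / ((m : ℝ) + 1) :=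
      one_div_le_one_div_of_le (by positivity) (by have : (m : ℝ) ≤ n := by exact_mod_cast hmn
                                                   linarith)
    rw [Set.mem_ofPred_eq] at h1 h2
    exact ⟨hp, h1.trans this, le_trans (b := ν - 1 / ((n : ℝ) + 1)) (by linarith) h2⟩
  have key : ∀ p, (∀ n, p ∈ Z n) → ∃ x ∈ posSet, psiAt c d t c₁ x p - entropy ![p 0] < 0 := by
    intro p hp
    have ht : Tendsto (fun n : ℕ => 1 / ((n : ℝ) + 1)) atTop (𝓝 0) :=
      tendsto_one_div_add_atTop_nhds_zero_nat
    have hF := (hp 0).1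
    have e1 : |p 0 - α| ≤ 0 := ge_of_tendsto ht (Eventually.of_forall fun n => (hp n).2.1)
    have e2 : ν - 0 ≤ p 1 + p 2 :=
      le_of_tendsto (ht.const_sub ν) (Eventually.of_forall fun n => (hp n).2.2)
    have e3 : p 0 = α := by
      have := abs_nonpos_iff.1 e1
      linarith
    by_contra! hcon
    have := le_fR (r := 0) (ν := ν) hF (by rw [e3]; exact h0) (by linarith) hcon
    rw [e3] at this
    exact absurd h (not_lt.2 (by exact_mod_cast this))
  obtain ⟨n, hn⟩ := exists_le_neg_of_nested
    (fun x => (continuous_psiAt c d t c₁ x).sub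
      (continuous_entropy_one.comp (continuous_apply 0))) hZ
    ((isCompact_setOf_feasiblePt A).of_isClosed_subset (hcl 0) Set.inter_subset_left) hcl key
  exact ⟨1 / ((n : ℝ) + 1), by positivity, fun p hp h1 h2 => hn p ⟨hp, h1, h2⟩⟩

end

end GLDPC

namespace GLDPC

noncomputable section

variable {N c J d : ℕ}

/-! ### One iteration of the decoder -/

/-- The sockets of check `j` that are attached to a variable in `E`. -/
def errSockets (π : Tanner N c J d) (E : Finset (Fin N)) (j : Fin J) : Finset (Fin d) :=
  Finset.univ.filter fun m => (π.symm (j, m)).1 ∈ E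

/-- The checks that see more than `t` errors. -/
def badChecks (t : ℕ) (π : Tanner N c J d) (E : Finset (Fin N)) : Finset (Fin J) :=
  Finset.univ.filter fun j => t < (errSockets π E j).card

/-- The sockets of variable `i` that are attached to a bad check. -/
def badSockets (t : ℕ) (π : Tanner N c J d) (E : Finset (Fin N)) (i : Fin N) : Finset (Fin c) :=
  Finset.univ.filter fun k => (π (i, k)).1 ∈ badChecks t π E

/-- The corrupt variables that may remain corrupt. -/
def stay (t c₁ : ℕ) (π : Tanner N c J d) (E : Finset (Fin N)) : Finset (Fin N) :=
  E.filter fun i => c - c₁ + 1 ≤ (badSockets t π E i).card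

/-- The correct variables that may become corrupt. -/
def spread (t c₁ : ℕ) (π : Tanner N c J d) (E : Finset (Fin N)) : Finset (Fin N) :=
  Eᶜ.filter fun i => c₁ ≤ (badSockets t π E i).card

variable {t c₁ : ℕ} {C₀ : Submodule (ZMod 2) (Fin d → ZMod 2)} {π : Tanner N c J d}
  {x : Fin N → ZMod 2}

theorem zmod_two_eq_add_one {a b : ZMod 2} (h : a ≠ b) : a = b + 1 := by
  revert a b; decide

theorem corrupt_ne_iff (x : Fin N → ZMod 2) (E : Finset (Fin N)) (i : Fin N) :
    corrupt x E i ≠ x i ↔ i ∈ E := by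
  unfold corrupt
  split_ifs with h <;> simp [h]

theorem mem_errSockets_iff (π : Tanner N c J d) (x : Fin N → ZMod 2) (E : Finset (Fin N))
    (j : Fin J) (m : Fin d) :
    m ∈ errSockets π E j ↔ checkInput π x j m ≠ checkInput π (corrupt x E) j m := by
  simp only [errSockets, Finset.mem_filter, Finset.mem_univ, true_and, checkInput]
  rw [ne_comm, corrupt_ne_iff]

theorem hammingDist_checkInput (π : Tanner N c J d) (x : Fin N → ZMod 2) (E : Finset (Fin N))
    (j : Fin J) :
    hammingDist (checkInput π x j) (checkInput π (corrupt x E) j)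
      = (errSockets π E j).card := by
  unfold hammingDist
  congr 1
  ext m
  rw [mem_errSockets_iff π x]
  simp

/-- A good check sends correct messages. -/
theorem sendsFlip_iff (hC₀ : ∀ w ∈ C₀, w ≠ 0 → 2 * t + 1 ≤ hammingNorm w)
    (hx : IsCodeword C₀ π x) (E : Finset (Fin N)) {s : Fin J × Fin d}
    (hs : s.1 ∉ badChecks t π E) :
    SendsFlip C₀ t π (corrupt x E) s ↔ (π.symm s).1 ∈ E := by
  have hle : hammingDist (checkInput π x s.1) (checkInput π (corrupt x E) s.1) ≤ t := by
    rw [hammingDist_checkInput]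
    simpa [badChecks] using hs
  have hex : ∃ w ∈ C₀, hammingDist w (checkInput π (corrupt x E) s.1) ≤ t := ⟨_, hx s.1, hle⟩
  -- Two distinct words of `C₀` within `t` of the same input would be at distance at most `2 t`.
  have hch : hex.choose = checkInput π x s.1 := by
    by_contra hne
    have h1 := hC₀ _ (C₀.sub_mem hex.choose_spec.1 (hx s.1)) (sub_ne_zero.2 hne)
    rw [← neg_add_eq_sub, ← hammingDist_eq_hammingNorm, hammingDist_comm] at h1
    have h2 := hammingDist_triangle_right hex.choose (checkInput π x s.1)
      (checkInput π (corrupt x E) s.1)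
    have h3 := hex.choose_spec.2
    omega
  have hB : BDD C₀ t (checkInput π (corrupt x E) s.1) = some (checkInput π x s.1) := by
    unfold BDD
    rw [dif_pos hex, hch]
  have hm := mem_errSockets_iff π x E s.1 s.2
  simp only [errSockets, Finset.mem_filter, Finset.mem_univ, true_and] at hm
  unfold SendsFlip
  rw [hB]
  simp only [Option.some.injEq, exists_eq_left']
  exact hm.symm

/-- Over `GF(2)` every word is `x` corrupted on the set where it differs. A variable that stays
corrupt received fewer than `c₁` flips although each good socket sent one; a variable that becomes
corrupt received its flips from bad sockets only. Bad checks can behave arbitrarily, hence only an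
inclusion. -/
theorem exists_step_corrupt (hC₀ : ∀ w ∈ C₀, w ≠ 0 → 2 * t + 1 ≤ hammingNorm w)
    (hc : c₁ ≤ c) (hx : IsCodeword C₀ π x) (E : Finset (Fin N)) :
    ∃ E', step C₀ t c₁ π (corrupt x E) = corrupt x E' ∧
      E' ⊆ stay t c₁ π E ∪ spread t c₁ π E := by
  classical
  refine ⟨Finset.univ.filter fun i => step C₀ t c₁ π (corrupt x E) i ≠ x i, ?_, ?_⟩
  · funext i
    by_cases h : step C₀ t c₁ π (corrupt x E) i = x i
    · simp [corrupt, h]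
    · simpa [corrupt, h] using zmod_two_eq_add_one h
  · intro i hi
    rw [Finset.mem_filter] at hi
    have hi := hi.2
    rw [Finset.mem_union]
    have hsend : ∀ k, k ∉ badSockets t π E i →
        (SendsFlip C₀ t π (corrupt x E) (π (i, k)) ↔ i ∈ E) := fun k hk => by
      have := sendsFlip_iff hC₀ hx E (s := π (i, k)) (by simpa [badSockets] using hk)
      simpa using this
    by_cases hE : i ∈ E
    · left
      have hflip : ¬ c₁ ≤ flipCount C₀ t π (corrupt x E) i := by
        intro h
        apply hi
        simp only [step, if_pos h, corrupt, if_pos hE]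
        rw [add_assoc, show (1 + 1 : ZMod 2) = 0 from rfl, add_zero]
      refine Finset.mem_filter.2 ⟨hE, ?_⟩
      have hsub : (badSockets t π E i)ᶜ ⊆
          Finset.univ.filter fun k : Fin c => SendsFlip C₀ t π (corrupt x E) (π (i, k)) :=
        fun k hk => by simpa using (hsend k (Finset.mem_compl.1 hk)).2 hE
      have h1 := Finset.card_le_card hsub
      rw [Finset.card_compl, Fintype.card_fin] at h1
      have h2 : (Finset.univ.filter fun k : Fin c =>
        SendsFlip C₀ t π (corrupt x E) (π (i, k))).card = flipCount C₀ t π (corrupt x E) i := by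
        unfold flipCount
        congr
      have h3 := Finset.card_le_univ (badSockets t π E i)
      rw [Fintype.card_fin] at h3
      omega
    · right
      have hflip : c₁ ≤ flipCount C₀ t π (corrupt x E) i := by
        by_contra h
        apply hi
        simp only [step, if_neg h, corrupt, if_neg hE]
      refine Finset.mem_filter.2 ⟨Finset.mem_compl.2 hE, hflip.trans (Finset.card_le_card ?_)⟩
      intro k hk
      by_contra hk'
      exact hE ((hsend k hk').1 (by simpa using hk))

theorem stay_union_spread_empty (hc₁ : 0 < c₁) :
    stay t c₁ π ∅ ∪ spread t c₁ π ∅ = ∅ := by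
  have h : ∀ i, badSockets t π ∅ i = ∅ := fun i => by
    simp [badSockets, badChecks, errSockets]
  simp [stay, spread, h, hc₁.ne']

theorem corrupt_empty (x : Fin N → ZMod 2) : corrupt x ∅ = x := by
  funext i; simp [corrupt]

/-- The decoder succeeds if small error sets shrink and `E` becomes small in one step. -/
theorem corrects_of_forall_shrink (hC₀ : ∀ w ∈ C₀, w ≠ 0 → 2 * t + 1 ≤ hammingNorm w)
    (hc : c₁ ≤ c) (hc₁ : 0 < c₁) {E : Finset (Fin N)} {m : ℕ}
    (hF : ∀ F : Finset (Fin N), F.Nonempty → F.card ≤ m →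
      (stay t c₁ π F).card + (spread t c₁ π F).card < F.card)
    (hE : (stay t c₁ π E).card + (spread t c₁ π E).card ≤ m) :
    Corrects C₀ t c₁ π E := by
  intro x hx
  -- A small set loses at least one element per iteration, so `l` iterations suffice for size at
  -- most `l`; the empty error set then persists.
  have key : ∀ l : ℕ, ∀ F : Finset (Fin N), F.card ≤ m → F.card ≤ l →
      (step C₀ t c₁ π)^[l] (corrupt x F) = x := by
    intro l
    induction l with
    | zero =>
      intro F _ h0
      rw [Finset.card_eq_zero.1 (Nat.le_zero.1 h0)]
      exact corrupt_empty x
    | succ l ih =>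
      intro F hm hl
      obtain ⟨F', h1, h2⟩ := exists_step_corrupt (c₁ := c₁) hC₀ hc hx F
      rw [Function.iterate_succ_apply, h1]
      rcases F.eq_empty_or_nonempty with rfl | hne
      · rw [stay_union_spread_empty hc₁, Finset.subset_empty] at h2
        subst h2
        exact ih _ hm (by simp)
      · have h3 := hF F hne hm
        have h4 := (Finset.card_le_card h2).trans (Finset.card_union_le _ _)
        exact ih F' (by omega) (by omega)
  obtain ⟨E', h1, h2⟩ := exists_step_corrupt (c₁ := c₁) hC₀ hc hx E
  have h4 := (Finset.card_le_card h2).trans (Finset.card_union_le _ _)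
  filter_upwards [eventually_ge_atTop (E'.card + 1)] with l hl
  obtain ⟨l, rfl⟩ := Nat.exists_eq_add_of_le' (by omega : 1 ≤ l)
  rw [Function.iterate_succ_apply, h1]
  exact key l E' (by omega) (by omega)

end

end GLDPC

namespace GLDPC

noncomputable section

/-! ### Counting matchings -/

section Generic
variable {ι κ X Y : Type*} [Fintype ι] [DecidableEq ι] [Fintype κ] [DecidableEq κ]

/-- The bijections compatible with two labellings, if any exist, form a coset of the stabilizer of
`u`, whose order is the product of the factorials of the fibre sizes. -/
theorem card_equiv_comp_eq_le [Fintype X] [DecidableEq X] [Fintype Y] [DecidableEq Y]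
    (u : X → κ) (v : Y → κ) :
    (Finset.univ.filter fun e : X ≃ Y => ∀ a, v (e a) = u a).card
      ≤ ∏ k, (Finset.univ.filter fun a => u a = k).card.factorial := by
  classical
  rcases (Finset.univ.filter fun e : X ≃ Y => ∀ a, v (e a) = u a).eq_empty_or_nonempty with h | h
  · rw [h]; simp
  · obtain ⟨e₀, h₀⟩ := h
    have h₀ : ∀ a, v (e₀ a) = u a := by simpa using h₀
    have hs := DomMulAct.stabilizer_card u
    rw [Fintype.card_subtype] at hs
    simp only [Fintype.card_subtype] at hs
    rw [← hs]
    refine Finset.card_le_card_of_injOn (fun e => e.trans e₀.symm) ?_ ?_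
    · intro e he
      have he : ∀ a, v (e a) = u a := by simpa using he
      simp only [Finset.coe_filter, Finset.mem_univ, true_and, Set.mem_ofPred_eq]
      funext a
      have := h₀ (e₀.symm (e a))
      rw [Equiv.apply_symm_apply, he] at this
      simpa using this.symm
    · intro e _ e' _ h
      ext a
      have := congrArg (fun σ => e₀ (σ a)) h
      simpa using this

theorem card_filter_mem_mem (E : Finset ι) (S : ι → Finset κ) :
    (Finset.univ.filter fun s : ι × κ => s.1 ∈ E ∧ s.2 ∈ S s.1).card = ∑ i ∈ E, (S i).card := by
  rw [Finset.card_filter, Fintype.sum_prod_type, ← Finset.sum_subset (Finset.subset_univ E)]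
  · refine Finset.sum_congr rfl fun i hi => ?_
    simp [hi]
  · intro i _ hi
    simp [hi]

theorem prod_ite_mem_of_subset {ι : Type*} [DecidableEq ι] {E W : Finset ι} (hW : W ⊆ E) (a b : ℝ) :
    ∏ i ∈ E, (if i ∈ W then a else b) = a ^ W.card * b ^ (E.card - W.card) := by
  rw [Finset.prod_ite, Finset.prod_const, Finset.prod_const]
  have h1 : E.filter (fun i => i ∈ W) = W := by
    ext i; simp only [Finset.mem_filter]; exact ⟨fun h => h.2, fun h => ⟨hW h, h⟩⟩
  have h2 : E.filter (fun i => i ∉ W) = E \ W := by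
    ext i; simp
  rw [h1, h2, Finset.card_sdiff_of_subset hW]

/-- The subsets of `Fin m` with between `a` and `b` elements. -/
def slab (m a b : ℕ) : Finset (Finset (Fin m)) :=
  Finset.univ.filter fun s => a ≤ s.card ∧ s.card ≤ b

theorem sum_slab {m a b : ℕ} (hb : b ≤ m) (y : ℝ) :
    ∑ s ∈ slab m a b, y ^ s.card = binomPoly m a b y := by
  unfold slab binomPoly
  rw [Finset.sum_filter]
  have h := Finset.sum_powerset_apply_card
    (fun j => if a ≤ j ∧ j ≤ b then y ^ j else 0) (x := (Finset.univ : Finset (Fin m)))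
  rw [Finset.powerset_univ] at h
  rw [h, Finset.card_univ, Fintype.card_fin]
  symm
  refine Finset.sum_subset_zero_on_sdiff ?_ ?_ ?_
  · intro j hj
    simp only [Finset.mem_Icc, Finset.mem_range] at *
    omega
  · intro j hj
    simp only [Finset.mem_sdiff, Finset.mem_Icc] at hj
    rw [if_neg hj.2, smul_zero]
  · intro j hj
    rw [if_pos (Finset.mem_Icc.1 hj), nsmul_eq_mul]

/-- Expanding the product gives a sum of nonnegative monomials over all admissible families, and
each member of `Q` contributes exactly `q`. This is the bound of a coefficient by a value of the
generating function, and the source of the infima in `rho`. -/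
theorem card_mul_le_prod {m : ℕ} (A : ι → Finset (Finset (Fin m))) {y : ι → ℝ}
    (hy : ∀ i, 0 ≤ y i) (Q : Finset (ι → Finset (Fin m))) (q : ℝ)
    (hQ : ∀ S ∈ Q, ∀ i, S i ∈ A i) (hq : ∀ S ∈ Q, ∏ i, y i ^ (S i).card = q) :
    Q.card * q ≤ ∏ i, ∑ s ∈ A i, y i ^ s.card := by
  rw [Finset.prod_univ_sum, ← nsmul_eq_mul, ← Finset.sum_const]
  rw [← Finset.sum_congr rfl hq]
  refine Finset.sum_le_sum_of_subset_of_nonneg (fun S hS => ?_) fun S _ _ => ?_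
  · exact Fintype.mem_piFinset.2 (hQ S hS)
  · exact Finset.prod_nonneg fun i _ => pow_nonneg (hy i) _

theorem prod_ite_pow_card {m : ℕ} (E : Finset ι) (S : ι → Finset (Fin m)) (a b : ℝ) :
    ∏ i, (if i ∈ E then a else b) ^ (S i).card
      = a ^ (∑ i ∈ E, (S i).card) * b ^ (∑ i ∈ Eᶜ, (S i).card) := by
  rw [← Finset.prod_mul_prod_compl E, ← Finset.prod_pow_eq_pow_sum, ← Finset.prod_pow_eq_pow_sum]
  congr 1
  · exact Finset.prod_congr rfl fun i hi => by rw [if_pos hi]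
  · exact Finset.prod_congr rfl fun i hi => by rw [if_neg (Finset.mem_compl.1 hi)]

end Generic

/-! ### Edge counts and matchings with prescribed staying, spreading and bad sets -/

variable {N c J d : ℕ}

/-- The number of edges between `E` and the bad checks. -/
def badEdges (t : ℕ) (π : Tanner N c J d) (E : Finset (Fin N)) : ℕ :=
  ∑ i ∈ E, (badSockets t π E i).card

variable (t c₁ : ℕ) (π : Tanner N c J d) (E : Finset (Fin N))

theorem mem_badSockets (i : Fin N) (k : Fin c) :
    k ∈ badSockets t π E i ↔ (π (i, k)).1 ∈ badChecks t π E := by simp [badSockets]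

theorem mem_errSockets (j : Fin J) (m : Fin d) :
    m ∈ errSockets π E j ↔ (π.symm (j, m)).1 ∈ E := by simp [errSockets]

theorem sum_badSockets :
    ∑ i ∈ Finset.univ, (badSockets t π E i).card = (badChecks t π E).card * d := by
  have h := card_filter_mem_mem (badChecks t π E) (fun _ => (Finset.univ : Finset (Fin d)))
  rw [Finset.sum_const, Finset.card_univ, Fintype.card_fin, smul_eq_mul] at h
  rw [← h, ← card_filter_mem_mem]
  exact Finset.card_equiv π fun s => by simp [mem_badSockets]

theorem sum_errSockets :
    ∑ j ∈ Finset.univ, (errSockets π E j).card = E.card * c := by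
  have h := card_filter_mem_mem E (fun _ => (Finset.univ : Finset (Fin c)))
  rw [Finset.sum_const, Finset.card_univ, Fintype.card_fin, smul_eq_mul] at h
  rw [← h, ← card_filter_mem_mem]
  exact Finset.card_equiv π.symm fun s => by simp [mem_errSockets]

theorem sum_errSockets_badChecks :
    ∑ j ∈ badChecks t π E, (errSockets π E j).card = badEdges t π E := by
  rw [badEdges, ← card_filter_mem_mem, ← card_filter_mem_mem]
  exact Finset.card_equiv π.symm fun s => by
    simp [mem_errSockets, mem_badSockets, and_comm]

theorem badEdges_add_sum_compl :
    badEdges t π E + ∑ i ∈ Eᶜ, (badSockets t π E i).card = (badChecks t π E).card * d := by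
  rw [← sum_badSockets, badEdges, Finset.sum_add_sum_compl]

theorem badEdges_add_sum_compl_badChecks :
    badEdges t π E + ∑ j ∈ (badChecks t π E)ᶜ, (errSockets π E j).card = E.card * c := by
  rw [← sum_errSockets π E, ← sum_errSockets_badChecks, Finset.sum_add_sum_compl]

variable {t c₁}

/-- A matching determines the bad sockets on the variable side and the error sockets on the check
side. Given both patterns, it must respect the four classes of edges: `w` from `E` to bad checks,
`r` from `E` to good checks, `v` from outside `E` to bad checks, and `z` remaining ones. The
patterns are counted by generating functions, with `x 0, x 1` for variables and `x 2, x 3` for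
checks. -/
theorem card_matchings_le (W₁ W₂ : Finset (Fin N)) (B : Finset (Fin J)) {w v r z : ℕ}
    (htd : t ≤ d) (hc₁ : 1 ≤ c₁) (hcc : c₁ ≤ c)
    (hv : w + v = B.card * d) (hr : w + r = E.card * c) (hz : v + z = Eᶜ.card * c)
    (hW₁ : W₁ ⊆ E) (hW₂ : W₂ ⊆ Eᶜ) {x : Fin 4 → ℝ} (hx : x ∈ posSet) :
    ((Finset.univ.filter fun π : Tanner N c J d => stay t c₁ π E = W₁ ∧ spread t c₁ π E = W₂ ∧
        badChecks t π E = B ∧ badEdges t π E = w).card : ℝ)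
      * (x 0 ^ w * x 1 ^ v) * (x 2 ^ w * x 3 ^ r)
    ≤ (F0 c c₁ (x 0) ^ W₁.card * F1 c c₁ (x 0) ^ (E.card - W₁.card)
        * (F2 c c₁ (x 1) ^ W₂.card * F3 c c₁ (x 1) ^ (Eᶜ.card - W₂.card)))
      * (G0 d t (x 2) ^ B.card * G1 d t (x 3) ^ (J - B.card))
      * (w.factorial * r.factorial * (v.factorial * z.factorial) : ℕ) := by
  classical
  set Z := Finset.univ.filter fun π : Tanner N c J d => stay t c₁ π E = W₁ ∧
    spread t c₁ π E = W₂ ∧ badChecks t π E = B ∧ badEdges t π E = w with hZ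
  have hZm : ∀ π ∈ Z, stay t c₁ π E = W₁ ∧ spread t c₁ π E = W₂ ∧
    badChecks t π E = B ∧ badEdges t π E = w := fun π hπ => by simpa [hZ] using hπ
  set Q₁ := Z.image fun π => badSockets t π E with hQ₁
  set Q₂ := Z.image fun π => errSockets π E with hQ₂
  have h0 := (hx 0).le; have h1 := (hx 1).le; have h2 := (hx 2).le; have h3 := (hx 3).le
  -- the fibres
  have hfib : Z.card ≤ (w.factorial * r.factorial * (v.factorial * z.factorial))
      * (Q₁ ×ˢ Q₂).card := by
    refine Finset.card_le_mul_card_image_of_maps_to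
      (f := fun π => (badSockets t π E, errSockets π E)) (fun π hπ => ?_) _ ?_
    · exact Finset.mem_product.2 ⟨Finset.mem_image_of_mem _ hπ, Finset.mem_image_of_mem _ hπ⟩
    · rintro ⟨S, T⟩ hST
      obtain ⟨π₀, hπ₀, rfl⟩ := Finset.mem_image.1 (Finset.mem_product.1 hST).1
      obtain ⟨-, -, hB₀, hw₀⟩ := hZm π₀ hπ₀
      set S := badSockets t π₀ E with hS
      -- Both labels mean (attached to `E`, attached to a bad check), read off from opposite ends of
      -- the edge.
      let u : Fin N × Fin c → Bool × Bool := fun s => (decide (s.1 ∈ E), decide (s.2 ∈ S s.1))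
      let u' : Fin J × Fin d → Bool × Bool := fun s => (decide (s.2 ∈ T s.1), decide (s.1 ∈ B))
      refine le_trans (Finset.card_le_card (t := Finset.univ.filter
        fun e : Tanner N c J d => ∀ a, u' (e a) = u a) ?_) ((card_equiv_comp_eq_le u u').trans
          (le_of_eq ?_))
      · intro π hπ
        rw [Finset.mem_filter, Prod.mk.injEq] at hπ
        obtain ⟨hπZ, hπS, hπT⟩ := hπ
        obtain ⟨-, -, hB, -⟩ := hZm π hπZ
        rw [Finset.mem_filter]
        refine ⟨Finset.mem_univ _, fun a => ?_⟩
        simp only [u, u', Prod.mk.injEq, decide_eq_decide]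
        rw [← hπS, ← hπT, mem_badSockets, hB, mem_errSockets]
        simp
      · have hwS : ∑ i ∈ E, (S i).card = w := hw₀
        have hvS : ∑ i ∈ Eᶜ, (S i).card = v := by
          have := badEdges_add_sum_compl t π₀ E
          rw [hB₀, hw₀] at this
          simp only [hS]
          omega
        have hE : ∀ F : Finset (Fin N), ∑ i ∈ F, (S i).card + ∑ i ∈ F, ((S i)ᶜ).card
            = F.card * c := fun F => by
          rw [← Finset.sum_add_distrib]
          simp [Finset.card_add_card_compl]
        have e1 : (Finset.univ.filter fun a => u a = (true, true)).card = w := by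
          rw [← hwS, ← card_filter_mem_mem]
          simp [u]
        have e2 : (Finset.univ.filter fun a => u a = (true, false)).card = r := by
          have : (Finset.univ.filter fun a => u a = (true, false)).card
              = ∑ i ∈ E, ((S i)ᶜ).card := by
            rw [← card_filter_mem_mem E (fun i => (S i)ᶜ)]
            simp [u]
          have := hE E
          omega
        have e3 : (Finset.univ.filter fun a => u a = (false, true)).card = v := by
          rw [← hvS, ← card_filter_mem_mem]
          simp [u]
        have e4 : (Finset.univ.filter fun a => u a = (false, false)).card = z := by
          have : (Finset.univ.filter fun a => u a = (false, false)).card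
              = ∑ i ∈ Eᶜ, ((S i)ᶜ).card := by
            rw [← card_filter_mem_mem Eᶜ (fun i => (S i)ᶜ)]
            simp [u]
          have := hE Eᶜ
          omega
        rw [Fintype.prod_prod_type]
        simp only [Fintype.prod_bool]
        rw [e1, e2, e3, e4]
  -- the variable side
  have hV : (Q₁.card : ℝ) * (x 0 ^ w * x 1 ^ v) ≤
      F0 c c₁ (x 0) ^ W₁.card * F1 c c₁ (x 0) ^ (E.card - W₁.card)
        * (F2 c c₁ (x 1) ^ W₂.card * F3 c c₁ (x 1) ^ (Eᶜ.card - W₂.card)) := by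
    let A : Fin N → Finset (Finset (Fin c)) := fun i =>
      if i ∈ E then (if i ∈ W₁ then slab c (c - c₁ + 1) c else slab c 0 (c - c₁))
      else (if i ∈ W₂ then slab c c₁ c else slab c 0 (c₁ - 1))
    refine (card_mul_le_prod A (y := fun i => if i ∈ E then x 0 else x 1)
      (fun i => by split_ifs <;> assumption) Q₁ _ ?_ ?_).trans (le_of_eq ?_)
    · intro S hS i
      obtain ⟨π, hπ, rfl⟩ := Finset.mem_image.1 hS
      obtain ⟨h1, h2, -, -⟩ := hZm π hπ
      have hle := Finset.card_le_univ (badSockets t π E i)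
      rw [Fintype.card_fin] at hle
      simp only [A, ← h1, ← h2, stay, spread, Finset.mem_filter, Finset.mem_compl]
      by_cases hiE : i ∈ E
      · rw [if_pos hiE]
        split_ifs with h <;> simp only [slab, Finset.mem_filter, Finset.mem_univ, true_and]
        · exact ⟨h.2, hle⟩
        · refine ⟨Nat.zero_le _, ?_⟩
          have : ¬ c - c₁ + 1 ≤ (badSockets t π E i).card := fun hh => h ⟨hiE, hh⟩
          omega
      · rw [if_neg hiE]
        split_ifs with h <;> simp only [slab, Finset.mem_filter, Finset.mem_univ, true_and]
        · exact ⟨h.2, hle⟩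
        · refine ⟨Nat.zero_le _, ?_⟩
          have : ¬ c₁ ≤ (badSockets t π E i).card := fun hh => h ⟨hiE, hh⟩
          omega
    · intro S hS
      obtain ⟨π, hπ, rfl⟩ := Finset.mem_image.1 hS
      obtain ⟨-, -, hB, hw⟩ := hZm π hπ
      have h5 := badEdges_add_sum_compl t π E
      rw [hB, hw] at h5
      rw [prod_ite_pow_card, show ∑ i ∈ E, (badSockets t π E i).card = w from hw,
        show ∑ i ∈ Eᶜ, (badSockets t π E i).card = v by omega]
    · rw [← Finset.prod_mul_prod_compl E, ← prod_ite_mem_of_subset hW₁,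
        ← prod_ite_mem_of_subset hW₂]
      congr 1
      · refine Finset.prod_congr rfl fun i hi => ?_
        simp only [A, if_pos hi]
        split_ifs
        · exact sum_slab le_rfl _
        · exact sum_slab (by omega) _
      · refine Finset.prod_congr rfl fun i hi => ?_
        simp only [A, if_neg (Finset.mem_compl.1 hi)]
        split_ifs
        · exact sum_slab le_rfl _
        · exact sum_slab (by omega) _
  -- the check side
  have hC : (Q₂.card : ℝ) * (x 2 ^ w * x 3 ^ r) ≤
      G0 d t (x 2) ^ B.card * G1 d t (x 3) ^ (J - B.card) := by
    let A : Fin J → Finset (Finset (Fin d)) := fun j =>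
      if j ∈ B then slab d (t + 1) d else slab d 0 t
    refine (card_mul_le_prod A (y := fun j => if j ∈ B then x 2 else x 3)
      (fun i => by split_ifs <;> assumption) Q₂ _ ?_ ?_).trans (le_of_eq ?_)
    · intro T hT j
      obtain ⟨π, hπ, rfl⟩ := Finset.mem_image.1 hT
      obtain ⟨-, -, hB, -⟩ := hZm π hπ
      have hle := Finset.card_le_univ (errSockets π E j)
      rw [Fintype.card_fin] at hle
      simp only [A, ← hB, badChecks, Finset.mem_filter, Finset.mem_univ, true_and]
      split_ifs with h <;> simp only [slab, Finset.mem_filter, Finset.mem_univ, true_and] <;> omega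
    · intro T hT
      obtain ⟨π, hπ, rfl⟩ := Finset.mem_image.1 hT
      obtain ⟨-, -, hB, hw⟩ := hZm π hπ
      have h5 := badEdges_add_sum_compl_badChecks t π E
      have h6 := sum_errSockets_badChecks t π E
      rw [hB, hw] at h5 h6
      rw [prod_ite_pow_card, h6, show ∑ j ∈ Bᶜ, (errSockets π E j).card = r by omega]
    · have h7 := prod_ite_mem_of_subset (Finset.subset_univ B) (G0 d t (x 2)) (G1 d t (x 3))
      rw [Finset.card_univ, Fintype.card_fin] at h7
      rw [← h7]
      refine Finset.prod_congr rfl fun j _ => ?_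
      simp only [A]
      split_ifs
      · exact sum_slab le_rfl _
      · exact sum_slab htd _
  rw [Finset.card_product] at hfib
  have hfib' : (Z.card : ℝ) ≤ (w.factorial * r.factorial * (v.factorial * z.factorial) : ℕ)
      * (Q₁.card * Q₂.card) := by exact_mod_cast hfib
  have hq1 : 0 ≤ x 0 ^ w * x 1 ^ v := by positivity
  have hq2 : 0 ≤ x 2 ^ w * x 3 ^ r := by positivity
  calc (Z.card : ℝ) * (x 0 ^ w * x 1 ^ v) * (x 2 ^ w * x 3 ^ r)
      ≤ ((w.factorial * r.factorial * (v.factorial * z.factorial) : ℕ)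
        * (Q₁.card * Q₂.card)) * (x 0 ^ w * x 1 ^ v) * (x 2 ^ w * x 3 ^ r) := by gcongr
    _ = (Q₁.card * (x 0 ^ w * x 1 ^ v)) * (Q₂.card * (x 2 ^ w * x 3 ^ r))
        * (w.factorial * r.factorial * (v.factorial * z.factorial) : ℕ) := by ring
    _ ≤ _ := by
      refine mul_le_mul_of_nonneg_right ?_ (by positivity)
      exact mul_le_mul hV hC (by positivity) (le_trans (by positivity) hV)

end

end GLDPC

namespace GLDPC

noncomputable section

/-! ### Factorials and binomial coefficients -/

theorem exp_mul_log_nat (k : ℕ) : Real.exp (k * Real.log k) = (k : ℝ) ^ k := by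
  rcases k.eq_zero_or_pos with rfl | hk
  · simp
  · rw [← Real.log_pow, Real.exp_log (by positivity)]

/-- One term of the binomial expansion of `(k + j) ^ (k + j)`; `0 log 0 = 0` matches `0 ^ 0 = 1`. -/
theorem choose_le_exp {m k j : ℕ} (h : k + j = m) : (m.choose k : ℝ) ≤
    Real.exp (m * Real.log m - k * Real.log k - j * Real.log j) := by
  subst h
  have h1 := add_pow (k : ℝ) (j : ℝ) (k + j)
  have h2 : (k : ℝ) ^ k * (j : ℝ) ^ j * ((k + j).choose k : ℝ) ≤ ((k : ℝ) + j) ^ (k + j) := by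
    rw [h1]
    have := Finset.single_le_sum (s := Finset.range (k + j + 1))
      (f := fun i => (k : ℝ) ^ i * (j : ℝ) ^ (k + j - i) * ((k + j).choose i : ℝ))
      (fun _ _ => by positivity) (Finset.mem_range.2 (by omega : k < k + j + 1))
    simpa using this
  have hk : (0 : ℝ) < (k : ℝ) ^ k := by rw [← exp_mul_log_nat]; positivity
  have hj : (0 : ℝ) < (j : ℝ) ^ j := by rw [← exp_mul_log_nat]; positivity
  rw [Real.exp_sub, Real.exp_sub, exp_mul_log_nat, exp_mul_log_nat, exp_mul_log_nat, div_div,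
    le_div_iff₀ (by positivity)]
  push_cast
  linarith

theorem one_le_mul_log_succ_sub {k : ℕ} (hk : 0 < k) :
    1 ≤ ((k : ℝ) + 1) * (Real.log (k + 1) - Real.log k) := by
  have hk' : (0 : ℝ) < k := by exact_mod_cast hk
  rw [← Real.log_div (by positivity) (by positivity)]
  have h := Real.one_sub_inv_le_log_of_pos (show 0 < ((k : ℝ) + 1) / k by positivity)
  have h2 := mul_le_mul_of_nonneg_left h (show 0 ≤ (k : ℝ) + 1 by positivity)
  refine le_trans (le_of_eq ?_) h2
  field_simp
  ring

theorem mul_log_succ_sub_le_one (k : ℕ) :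
    (k : ℝ) * (Real.log (k + 1) - Real.log k) ≤ 1 := by
  rcases k.eq_zero_or_pos with rfl | hk
  · simp
  · have hk' : (0 : ℝ) < k := by exact_mod_cast hk
    rw [← Real.log_div (by positivity) (by positivity)]
    have h := Real.log_le_sub_one_of_pos (show 0 < ((k : ℝ) + 1) / k by positivity)
    have h2 := mul_le_mul_of_nonneg_left h hk'.le
    refine h2.trans (le_of_eq ?_)
    field_simp
    ring

/-- A weak Stirling bound. The induction gives the factor `k` for `k ≥ 1`; `k + 1` also covers `k =
0`. -/
theorem factorial_le_exp (k : ℕ) :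
    (k.factorial : ℝ) ≤ Real.exp 1 * (k + 1) * Real.exp (k * Real.log k - k) := by
  rcases k.eq_zero_or_pos with rfl | hk
  · simp
  have key : (k.factorial : ℝ) ≤ Real.exp (1 + Real.log k + k * Real.log k - k) := by
    induction k, hk using Nat.le_induction with
    | base => simp
    | succ k hk ih =>
      have hk' : (0 : ℝ) < (k : ℝ) + 1 := by positivity
      rw [Nat.factorial_succ]
      push_cast
      calc ((k : ℝ) + 1) * k.factorial
          ≤ Real.exp (Real.log (k + 1)) * Real.exp (1 + Real.log k + k * Real.log k - k) := by
            rw [Real.exp_log hk']; gcongr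
        _ ≤ _ := by
            rw [← Real.exp_add]
            refine Real.exp_le_exp.2 ?_
            have := one_le_mul_log_succ_sub hk
            linarith
  refine key.trans (le_of_eq_of_le (b := Real.exp 1 * k * Real.exp (k * Real.log k - k)) ?_ ?_)
  · rw [show 1 + Real.log k + k * Real.log k - k = 1 + Real.log k + (k * Real.log k - k) by ring,
      Real.exp_add, Real.exp_add, Real.exp_log (by exact_mod_cast hk)]
  · gcongr
    linarith

/-- The ratio of `k!` to `(k / e) ^ k` is nondecreasing, because `(1 + 1/k) ^ k ≤ e`. -/
theorem factorial_mul_exp_le {r M : ℕ} (h : r ≤ M) :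
    (r.factorial : ℝ) * Real.exp (M * Real.log M - M)
      ≤ M.factorial * Real.exp (r * Real.log r - r) := by
  induction M, h using Nat.le_induction with
  | base => rfl
  | succ M hM ih =>
    have hk' : (0 : ℝ) < (M : ℝ) + 1 := by positivity
    rw [Nat.factorial_succ]
    push_cast
    calc (r.factorial : ℝ) * Real.exp (((M : ℝ) + 1) * Real.log (M + 1) - (M + 1))
        ≤ r.factorial * (((M : ℝ) + 1) * Real.exp (M * Real.log M - M)) := by
          refine mul_le_mul_of_nonneg_left ?_ (by positivity)
          have hexp : ((M : ℝ) + 1) * Real.exp (M * Real.log M - M)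
              = Real.exp (Real.log (M + 1) + (M * Real.log M - M)) := by
            rw [Real.exp_add, Real.exp_log hk']
          rw [hexp]
          refine Real.exp_le_exp.2 ?_
          have := mul_log_succ_sub_le_one M
          linarith
      _ = ((M : ℝ) + 1) * (r.factorial * Real.exp (M * Real.log M - M)) := by ring
      _ ≤ ((M : ℝ) + 1) * (M.factorial * Real.exp (r * Real.log r - r)) := by gcongr
      _ = _ := by ring

/-- A lower bound for multinomial coefficients. -/
theorem factorial_prod_le {w r v z M : ℕ} (h : w + r + v + z = M) :
    ((w.factorial * r.factorial * (v.factorial * z.factorial) : ℕ) : ℝ)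
      ≤ M.factorial * (Real.exp 3 * ((w + 1) * (r + 1) * (v + 1)))
        * Real.exp (-(M * Real.log M - w * Real.log w - r * Real.log r - v * Real.log v
          - z * Real.log z)) := by
  have hz := factorial_mul_exp_le (show z ≤ M by omega)
  -- The class `z` may have order `N`. Comparing `z!` with `M!` directly avoids a power of `N`,
  -- which the sum over error sets of bounded size could not absorb.
  have hz' : (z.factorial : ℝ) ≤ M.factorial * Real.exp (z * Real.log z - z)
      * Real.exp (-(M * Real.log M - M)) := by
    rw [Real.exp_neg, ← div_eq_mul_inv, le_div_iff₀ (Real.exp_pos _)]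
    exact hz
  have hw := factorial_le_exp w
  have hr := factorial_le_exp r
  have hv := factorial_le_exp v
  push_cast
  calc (w.factorial : ℝ) * r.factorial * (v.factorial * z.factorial)
      ≤ (Real.exp 1 * (w + 1) * Real.exp (w * Real.log w - w))
        * (Real.exp 1 * (r + 1) * Real.exp (r * Real.log r - r))
        * ((Real.exp 1 * (v + 1) * Real.exp (v * Real.log v - v))
          * (M.factorial * Real.exp (z * Real.log z - z)
            * Real.exp (-(M * Real.log M - M)))) := by gcongr
    _ = M.factorial * ((w + 1) * (r + 1) * (v + 1))
        * (Real.exp 1 * Real.exp 1 * Real.exp 1 * Real.exp (w * Real.log w - w)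
          * Real.exp (r * Real.log r - r) * Real.exp (v * Real.log v - v)
          * Real.exp (z * Real.log z - z) * Real.exp (-(M * Real.log M - M))) := by ring
    _ = M.factorial * ((w + 1) * (r + 1) * (v + 1))
        * (Real.exp 3 * Real.exp (-(M * Real.log M - w * Real.log w - r * Real.log r
          - v * Real.log v - z * Real.log z))) := by
      simp only [← Real.exp_add]
      congr 2
      have : (M : ℝ) = w + r + v + z := by rw [← h]; push_cast; ring
      linear_combination this
    _ = _ := by ring

/-! ### The number of bad matchings -/

variable {N c J d t c₁ : ℕ}

theorem card_profile_le (E : Finset (Fin N)) {g l b w v r z : ℕ}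
    (htd : t ≤ d) (hc₁ : 1 ≤ c₁) (hcc : c₁ ≤ c)
    (hv : w + v = b * d) (hr : w + r = E.card * c) (hz : v + z = Eᶜ.card * c)
    {x : Fin 4 → ℝ} (hx : x ∈ posSet) :
    ((Finset.univ.filter fun π : Tanner N c J d => (stay t c₁ π E).card = g ∧
        (spread t c₁ π E).card = l ∧ (badChecks t π E).card = b ∧ badEdges t π E = w).card : ℝ)
      * (x 0 ^ w * x 1 ^ v * (x 2 ^ w * x 3 ^ r))
    ≤ (E.card.choose g * (Eᶜ.card.choose l * J.choose b))
      * ((F0 c c₁ (x 0) ^ g * F1 c c₁ (x 0) ^ (E.card - g)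
        * (F2 c c₁ (x 1) ^ l * F3 c c₁ (x 1) ^ (Eᶜ.card - l)))
      * (G0 d t (x 2) ^ b * G1 d t (x 3) ^ (J - b))
      * (w.factorial * r.factorial * (v.factorial * z.factorial) : ℕ)) := by
  classical
  set Z := Finset.univ.filter fun π : Tanner N c J d => (stay t c₁ π E).card = g ∧
    (spread t c₁ π E).card = l ∧ (badChecks t π E).card = b ∧ badEdges t π E = w with hZ
  set P := Finset.powersetCard g E ×ˢ Finset.powersetCard l Eᶜ ×ˢ
    Finset.powersetCard b (Finset.univ : Finset (Fin J)) with hP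
  have hPc : P.card = E.card.choose g * (Eᶜ.card.choose l * J.choose b) := by
    simp [hP]
  have hmap : Set.MapsTo (fun π : Tanner N c J d => (stay t c₁ π E, spread t c₁ π E,
      badChecks t π E)) Z P := by
    intro π hπ
    have hπ : (stay t c₁ π E).card = g ∧ (spread t c₁ π E).card = l ∧
      (badChecks t π E).card = b ∧ badEdges t π E = w := by simpa [hZ] using hπ
    simp only [hP, Finset.coe_product, Set.mem_prod, Finset.mem_coe, Finset.mem_powersetCard]
    exact ⟨⟨Finset.filter_subset _ _, hπ.1⟩, ⟨Finset.filter_subset _ _, hπ.2.1⟩,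
      Finset.subset_univ _, hπ.2.2.1⟩
  rw [show ((E.card.choose g : ℝ) * (Eᶜ.card.choose l * J.choose b)) = (P.card : ℝ) by
      rw [hPc]; push_cast; rfl, Finset.card_eq_sum_card_fiberwise hmap,
    Nat.cast_sum, Finset.sum_mul]
  refine (Finset.sum_le_card_nsmul P _ _ fun W hW => ?_).trans_eq (nsmul_eq_mul _ _)
  obtain ⟨W₁, W₂, B⟩ := W
  simp only [hP, Finset.mem_product, Finset.mem_powersetCard] at hW
  obtain ⟨⟨hW₁, rfl⟩, ⟨hW₂, rfl⟩, -, rfl⟩ := hW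
  have h := card_matchings_le (t := t) (c₁ := c₁) E W₁ W₂ B htd hc₁ hcc hv hr hz hW₁ hW₂ hx
  refine le_trans ?_ h
  rw [← mul_assoc]
  have hx0 := hx 0; have hx1 := hx 1; have hx2 := hx 2; have hx3 := hx 3
  gcongr
  intro π hπ
  simp only [hZ, Finset.mem_filter, Finset.mem_univ, true_and, Prod.mk.injEq] at hπ ⊢
  exact ⟨hπ.2.1, hπ.2.2.1, hπ.2.2.2, hπ.1.2.2.2⟩

end

end GLDPC

namespace GLDPC

noncomputable section

variable {N c J d t c₁ : ℕ}

/-! ### The exponent of the number of bad matchings -/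

/-- The point of the feasible region belonging to the cardinalities of an error pattern. -/
def profilePt (N c J n g l b w : ℕ) : Fin 5 → ℝ :=
  ![(n : ℝ) / N, (g : ℝ) / N, (l : ℝ) / N, (b : ℝ) / J, (w : ℝ) / (N * c)]

/-- The logarithm of the first-moment bound, without polynomial factors. -/
def profileExponent (N c J d t c₁ n n' g g' l l' b b' w v r z : ℕ) (x : Fin 4 → ℝ) : ℝ :=
  ((n * Real.log n - g * Real.log g - g' * Real.log g')
    + ((n' * Real.log n' - l * Real.log l - l' * Real.log l')
      + (J * Real.log J - b * Real.log b - b' * Real.log b')))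
  + ((g * Real.log (F0 c c₁ (x 0)) + g' * Real.log (F1 c c₁ (x 0))
      + (l * Real.log (F2 c c₁ (x 1)) + l' * Real.log (F3 c c₁ (x 1))))
    + (b * Real.log (G0 d t (x 2)) + b' * Real.log (G1 d t (x 3))))
  - (w * Real.log (x 0) + v * Real.log (x 1) + (w * Real.log (x 2) + r * Real.log (x 3)))
  - (((N * c : ℕ) : ℝ) * Real.log ((N * c : ℕ) : ℝ) - w * Real.log w - r * Real.log r
    - v * Real.log v - z * Real.log z)

theorem mul_negMulLog_div {a k : ℝ} (ha : 0 < a) :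
    a * Real.negMulLog (k / a) = k * Real.log a - k * Real.log k := by
  rw [negMulLog_div ha, Real.negMulLog]
  ring

/-- The normalizing logarithms of `N`, `N c` and `J` match by the conservation laws among the
counts. The term `-h(n/N)` appears because `E` is fixed, so that only subsets of `E` and of its
complement are chosen. -/
theorem profileExponent_eq {n n' g g' l l' b b' w v r z : ℕ} (x : Fin 4 → ℝ)
    (hN : 0 < N) (hc : 0 < c) (hd : 0 < d) (hNJ : N * c = J * d)
    (hn : n + n' = N) (hg : g + g' = n) (hl : l + l' = n') (hb : b + b' = J)
    (hv : w + v = b * d) (hr : w + r = n * c) (hz : v + z = n' * c) :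
    profileExponent N c J d t c₁ n n' g g' l l' b b' w v r z x
      = N * (psiAt c d t c₁ x (profilePt N c J n g l b w) - entropy ![(n : ℝ) / N]) := by
  have hN' : (0 : ℝ) < N := by exact_mod_cast hN
  have hc' : (0 : ℝ) < c := by exact_mod_cast hc
  have hd' : (0 : ℝ) < d := by exact_mod_cast hd
  have hM' : (0 : ℝ) < (N : ℝ) * c := by positivity
  have hNJ' : (N : ℝ) * c = J * d := by exact_mod_cast hNJ
  have hJ' : (0 : ℝ) < J := by
    by_contra! h
    nlinarith
  have hn' : (n : ℝ) + n' = N := by exact_mod_cast hn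
  have hg' : (g : ℝ) + g' = n := by exact_mod_cast hg
  have hl' : (l : ℝ) + l' = n' := by exact_mod_cast hl
  have hb' : (b : ℝ) + b' = J := by exact_mod_cast hb
  have hv' : (w : ℝ) + v = b * d := by exact_mod_cast hv
  have hr' : (w : ℝ) + r = n * c := by exact_mod_cast hr
  have hz' : (v : ℝ) + z = n' * c := by exact_mod_cast hz
  have q1 : (n : ℝ) / N - g / N = g' / N := by rw [← sub_div]; congr 1; linarith
  have q2 : 1 - ((g : ℝ) / N + g' / N + l / N) = l' / N := by
    field_simp; linarith
  have q3 : 1 - (n : ℝ) / N = n' / N := by field_simp; linarith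
  have q4 : 1 - (b : ℝ) / J = b' / J := by field_simp; linarith
  have qn : (n : ℝ) / N = (n * c) / (N * c) := by field_simp
  have qb : (b : ℝ) / J = (b * d) / (N * c) := by rw [hNJ']; field_simp
  have q5 : (n : ℝ) / N - w / (N * c) = r / (N * c) := by
    rw [qn, ← sub_div]; congr 1; linarith
  have q6 : (b : ℝ) / J - w / (N * c) = v / (N * c) := by
    rw [qb, ← sub_div]; congr 1; linarith
  have q7 : 1 - ((w : ℝ) / (N * c) + r / (N * c) + v / (N * c)) = z / (N * c) := by
    have : (N : ℝ) * c = w + r + v + z := by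
      rw [← hn', add_mul]; linarith
    field_simp
    linarith
  have q8 : (n' : ℝ) / N - l / N = l' / N := by rw [← sub_div]; congr 1; linarith
  have hcd : (N : ℝ) * (c / d) = J := by field_simp; linarith
  unfold psiAt entropyPart rhoAt profilePt
  simp only [Matrix.cons_val_zero, Matrix.cons_val_one, Matrix.cons_val]
  rw [entropy_three, entropy_one, entropy_three, entropy_one, q1, q2, q3, q4, q5, q6, q7, q8]
  have e1 := mul_negMulLog_div (k := g) hN'
  have e2 := mul_negMulLog_div (k := g') hN'
  have e3 := mul_negMulLog_div (k := l) hN'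
  have e4 := mul_negMulLog_div (k := l') hN'
  have e5 := mul_negMulLog_div (k := n) hN'
  have e6 := mul_negMulLog_div (k := n') hN'
  have e7 := mul_negMulLog_div (k := b) hJ'
  have e8 := mul_negMulLog_div (k := b') hJ'
  have e9 := mul_negMulLog_div (k := w) hM'
  have e10 := mul_negMulLog_div (k := r) hM'
  have e11 := mul_negMulLog_div (k := v) hM'
  have e12 := mul_negMulLog_div (k := z) hM'
  have r1 : (N : ℝ) * (g / N) = g := by field_simp
  have r2 : (N : ℝ) * (g' / N) = g' := by field_simp
  have r3 : (N : ℝ) * (l / N) = l := by field_simp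
  have r4 : (N : ℝ) * (l' / N) = l' := by field_simp
  have r5 : (N : ℝ) * (w / (N * c) * c) = w := by field_simp
  have r6 : (N : ℝ) * (v / (N * c) * c) = v := by field_simp
  have r7 : (N : ℝ) * (r / (N * c) * c) = r := by field_simp
  have r8 : (N : ℝ) * (b / J * c / d) = b := by
    rw [show (N : ℝ) * (b / J * c / d) = b / J * (N * (c / d)) by ring, hcd]; field_simp
  have r9 : (N : ℝ) * (b' / J * c / d) = b' := by
    rw [show (N : ℝ) * (b' / J * c / d) = b' / J * (N * (c / d)) by ring, hcd]; field_simp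
  have lhs : (N : ℝ) * ((Real.negMulLog (g / N) + Real.negMulLog (g' / N)
        + Real.negMulLog (l / N) + Real.negMulLog (l' / N)
        + c / d * (Real.negMulLog (b / J) + Real.negMulLog (b' / J))
        - c * (Real.negMulLog (w / (N * c)) + Real.negMulLog (r / (N * c))
          + Real.negMulLog (v / (N * c)) + Real.negMulLog (z / (N * c)))
        + (g / N * Real.log (F0 c c₁ (x 0)) + g' / N * Real.log (F1 c c₁ (x 0))
            - w / (N * c) * c * Real.log (x 0)
          + (l / N * Real.log (F2 c c₁ (x 1)) + l' / N * Real.log (F3 c c₁ (x 1))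
            - v / (N * c) * c * Real.log (x 1))
          + (b / J * c / d * Real.log (G0 d t (x 2)) - w / (N * c) * c * Real.log (x 2))
          + (b' / J * c / d * Real.log (G1 d t (x 3)) - r / (N * c) * c * Real.log (x 3))))
        - (Real.negMulLog (n / N) + Real.negMulLog (n' / N)))
      = (N * Real.negMulLog (g / N) + N * Real.negMulLog (g' / N)
        + N * Real.negMulLog (l / N) + N * Real.negMulLog (l' / N))
        + (N * (c / d)) * Real.negMulLog (b / J) + (N * (c / d)) * Real.negMulLog (b' / J)
        - (N * c * Real.negMulLog (w / (N * c)) + N * c * Real.negMulLog (r / (N * c))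
          + N * c * Real.negMulLog (v / (N * c)) + N * c * Real.negMulLog (z / (N * c)))
        + (N * (g / N) * Real.log (F0 c c₁ (x 0)) + N * (g' / N) * Real.log (F1 c c₁ (x 0))
            - N * (w / (N * c) * c) * Real.log (x 0)
          + (N * (l / N) * Real.log (F2 c c₁ (x 1)) + N * (l' / N) * Real.log (F3 c c₁ (x 1))
            - N * (v / (N * c) * c) * Real.log (x 1))
          + (N * (b / J * c / d) * Real.log (G0 d t (x 2))
            - N * (w / (N * c) * c) * Real.log (x 2))
          + (N * (b' / J * c / d) * Real.log (G1 d t (x 3))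
            - N * (r / (N * c) * c) * Real.log (x 3)))
        - (N * Real.negMulLog (n / N) + N * Real.negMulLog (n' / N)) := by ring
  rw [lhs, hcd, e1, e2, e3, e4, e5, e6, e7, e8, e9, e10, e11, e12, r1, r2, r3, r4, r5, r6, r7,
    r8, r9]
  unfold profileExponent
  push_cast
  have hM : (N : ℝ) * c = w + r + v + z := by rw [← hn', add_mul]; linarith
  generalize Real.log (N : ℝ) = LN
  generalize Real.log ((N : ℝ) * c) = LM
  generalize Real.log (J : ℝ) = LJ
  linear_combination -LN * hg' - LN * hl' - LM * hM - LJ * hb'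

end

end GLDPC

namespace GLDPC

noncomputable section

variable {N c J d t c₁ : ℕ}

theorem pow_eq_exp {a : ℝ} (ha : 0 < a) (k : ℕ) : a ^ k = Real.exp (k * Real.log a) := by
  rw [← Real.log_pow, Real.exp_log (pow_pos ha k)]

theorem card_profile_le_exp (A : Admissible c d t c₁) (E : Finset (Fin N))
    {n' g g' l l' b b' w v r z : ℕ}
    (hn : E.card + n' = N) (hg : g + g' = E.card) (hl : l + l' = n') (hb : b + b' = J)
    (hv : w + v = b * d) (hr : w + r = E.card * c) (hz : v + z = n' * c)
    {x : Fin 4 → ℝ} (hx : x ∈ posSet) :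
    ((Finset.univ.filter fun π : Tanner N c J d => (stay t c₁ π E).card = g ∧
        (spread t c₁ π E).card = l ∧ (badChecks t π E).card = b ∧ badEdges t π E = w).card : ℝ)
    ≤ ((N * c).factorial * (Real.exp 3 * ((w + 1) * (r + 1) * (v + 1))))
      * Real.exp (profileExponent N c J d t c₁ E.card n' g g' l l' b b' w v r z x) := by
  have hx0 := hx 0; have hx1 := hx 1; have hx2 := hx 2; have hx3 := hx 3
  have hEc : Eᶜ.card = n' := by rw [Finset.card_compl, Fintype.card_fin]; omega
  have i1 := A.lt_c; have i2 := A.two_le; have i3 := A.le_d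
  have h := card_profile_le (J := J) (d := d) (t := t) (c₁ := c₁) E (by omega) (by omega)
    (by omega) hv hr (hEc ▸ hz) hx (g := g) (l := l)
  rw [hEc, show E.card - g = g' by omega, show n' - l = l' by omega,
    show J - b = b' by omega] at h
  have hM : w + r + v + z = N * c := by
    rw [← hn, add_mul]; omega
  have hF := factorial_prod_le hM
  have c1 := choose_le_exp hg
  have c2 := choose_le_exp hl
  have c3 := choose_le_exp hb
  have hD : 0 < x 0 ^ w * x 1 ^ v * (x 2 ^ w * x 3 ^ r) := by positivity
  refine le_of_mul_le_mul_right (h.trans ?_) hD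
  have f0 := F0_pos A hx0
  have f1 := F1_pos (c := c) (c₁ := c₁) hx0
  have f2 := F2_pos A hx1
  have f3 := F3_pos (c := c) (c₁ := c₁) hx1
  have g0 := G0_pos A hx2
  have g1 := G1_pos (d := d) (t := t) hx3
  rw [pow_eq_exp f0, pow_eq_exp f1, pow_eq_exp f2, pow_eq_exp f3, pow_eq_exp g0, pow_eq_exp g1,
    pow_eq_exp hx0, pow_eq_exp hx1, pow_eq_exp hx2, pow_eq_exp hx3]
  simp only [← Real.exp_add]
  refine (mul_le_mul (mul_le_mul c1 (mul_le_mul c2 c3 (by positivity) (by positivity))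
    (by positivity) (by positivity)) (mul_le_mul_of_nonneg_left hF (by positivity))
    (by positivity) (by positivity)).trans (le_of_eq ?_)
  have e : ∀ a₁ a₂ a₃ u s p q : ℝ, Real.exp a₁ * (Real.exp a₂ * Real.exp a₃)
      * (Real.exp u * (((N * c).factorial : ℝ) * p * Real.exp q))
      = ((N * c).factorial * p) * Real.exp (a₁ + a₂ + a₃ + u + q) := by
    intro a₁ a₂ a₃ u s p q
    simp only [Real.exp_add]
    ring
  rw [e _ _ _ _ 0 _ _, mul_assoc _ (Real.exp _) (Real.exp _), ← Real.exp_add]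
  congr 2
  unfold profileExponent
  ring

/-! ### Feasibility of the profile -/

section
variable (t c₁) (π : Tanner N c J d) (E : Finset (Fin N))

theorem card_badChecks_mul_le : (badChecks t π E).card * (t + 1) ≤ badEdges t π E := by
  rw [← sum_errSockets_badChecks, ← smul_eq_mul]
  exact Finset.card_nsmul_le_sum _ _ _ fun j hj => (Finset.mem_filter.1 hj).2

theorem card_stay_mul_le : (stay t c₁ π E).card * (c - c₁ + 1) ≤ badEdges t π E := by
  refine le_trans ?_ (Finset.sum_le_sum_of_subset (show stay t c₁ π E ⊆ E from Finset.filter_subset _ _))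
  rw [← smul_eq_mul]
  exact Finset.card_nsmul_le_sum _ _ _ fun j hj => (Finset.mem_filter.1 hj).2

theorem card_spread_mul_le :
    (spread t c₁ π E).card * c₁ ≤ ∑ i ∈ Eᶜ, (badSockets t π E i).card := by
  refine le_trans ?_ (Finset.sum_le_sum_of_subset
    (show spread t c₁ π E ⊆ Eᶜ from Finset.filter_subset _ _))
  rw [← smul_eq_mul]
  exact Finset.card_nsmul_le_sum _ _ _ fun j hj => (Finset.mem_filter.1 hj).2

end

theorem sum_card_le_mul {ι : Type*} (F : Finset ι) {m : ℕ} (S : ι → Finset (Fin m)) :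
    ∑ i ∈ F, (S i).card ≤ F.card * m := by
  rw [← smul_eq_mul]
  exact Finset.sum_le_card_nsmul _ _ _ fun i _ => by simpa using Finset.card_le_univ (S i)

/-- After division by `N` or `J`, each constraint is nonnegativity of some count or one of the three
edge inequalities. -/
theorem feasiblePt_profilePt (A : Admissible c d t c₁) {n n' g g' l l' b w v r z : ℕ}
    (hN : 0 < N) (hNJ : N * c = J * d)
    (hn : n + n' = N) (hg : g + g' = n) (hl : l + l' = n')
    (hv : w + v = b * d) (hr : w + r = n * c) (hz : v + z = n' * c)
    (hbw : b * (t + 1) ≤ w) (hgw : g * (c - c₁ + 1) ≤ w) (hlv : l * c₁ ≤ v) :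
    FeasiblePt c d t c₁ (profilePt N c J n g l b w) := by
  have hN' : (0 : ℝ) < N := by exact_mod_cast hN
  have hc' := A.c_pos
  have hd' := A.d_pos
  have hc₁' := A.c₁_pos
  have hs := A.stay_pos
  have hM' : (0 : ℝ) < (N : ℝ) * c := by positivity
  have hNJ' : (N : ℝ) * c = J * d := by exact_mod_cast hNJ
  have hJ' : (0 : ℝ) < J := by
    by_contra! h
    nlinarith
  have hn' : (n : ℝ) + n' = N := by exact_mod_cast hn
  have hg' : (g : ℝ) + g' = n := by exact_mod_cast hg
  have hl' : (l : ℝ) + l' = n' := by exact_mod_cast hl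
  have hv' : (w : ℝ) + v = b * d := by exact_mod_cast hv
  have hr' : (w : ℝ) + r = n * c := by exact_mod_cast hr
  have hz' : (v : ℝ) + z = n' * c := by exact_mod_cast hz
  have hbw' : (b : ℝ) * (t + 1) ≤ w := by exact_mod_cast hbw
  have hgw' : (g : ℝ) * ((c : ℝ) - c₁ + 1) ≤ w := by
    have : ((g * (c - c₁ + 1) : ℕ) : ℝ) ≤ w := by exact_mod_cast hgw
    rwa [Nat.cast_mul, Nat.cast_add, Nat.cast_sub A.lt_c.le, Nat.cast_one] at this
  have hlv' : (l : ℝ) * c₁ ≤ v := by exact_mod_cast hlv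
  have z1 : (0 : ℝ) ≤ g' := g'.cast_nonneg
  have z2 : (0 : ℝ) ≤ l' := l'.cast_nonneg
  have z3 : (0 : ℝ) ≤ r := r.cast_nonneg
  have z4 : (0 : ℝ) ≤ v := v.cast_nonneg
  have z5 : (0 : ℝ) ≤ z := z.cast_nonneg
  have qw : (w : ℝ) / (N * c) * c = w / N := by field_simp
  have qb : (b : ℝ) / J * c = (b * d) / N := by
    rw [div_mul_eq_mul_div, div_eq_div_iff hJ'.ne' hN'.ne']
    linear_combination (b : ℝ) * hNJ'
  constructor <;> simp only [profilePt, Matrix.cons_val_zero, Matrix.cons_val_one,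
    Matrix.cons_val]
  · positivity
  · gcongr; linarith
  · positivity
  · rw [div_le_iff₀ hN', sub_mul, div_mul_cancel₀ _ hN'.ne']; linarith
  · positivity
  · rw [min_mul_of_nonneg _ _ hc'.le, qw, qb, div_mul_eq_mul_div]
    refine le_min ?_ ?_ <;> gcongr <;> linarith
  · rw [sub_mul, sub_mul, qw, qb, div_mul_eq_mul_div, ← sub_div, one_mul, div_le_iff₀ hN', sub_mul,
      div_mul_cancel₀ _ hN'.ne']
    have : (c : ℝ) * N = n * c + n' * c := by rw [← hn']; ring
    linarith
  · rw [div_mul_eq_mul_div, hNJ', show (w : ℝ) * d / (J * d) = w / J by field_simp,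
      div_div, div_le_div_iff₀ hJ' (by positivity), mul_left_comm, mul_comm (w : ℝ)]
    exact mul_le_mul_of_nonneg_left hbw' hJ'.le
  · rw [sub_mul, qw, qb, ← sub_div, div_div, div_le_div_iff₀ hN' (by positivity),
      show (b : ℝ) * d - w = v by linarith, mul_left_comm, mul_comm (v : ℝ)]
    exact mul_le_mul_of_nonneg_left hlv' hN'.le
  · rw [qw, div_div, div_le_div_iff₀ hN' (by positivity), mul_left_comm, mul_comm (w : ℝ)]
    exact mul_le_mul_of_nonneg_left hgw' hN'.le

/-! ### The number of matchings for which an error set grows -/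

theorem mul_succ_mul_exp_le {F w r v K X Y : ℝ} (hF : 0 ≤ F) (hr0 : 0 ≤ r)
    (hv0 : 0 ≤ v) (hK : 1 ≤ K) (hw : w ≤ K) (hr : r ≤ K) (hv : v ≤ K) (hXY : X ≤ Y) :
    F * (Real.exp 3 * ((w + 1) * (r + 1) * (v + 1))) * Real.exp X
      ≤ F * (Real.exp 3 * (2 * K) ^ 3) * Real.exp Y := by
  rw [pow_succ, pow_two]
  gcongr <;> linarith

/-- A profile that occurs is feasible, and `h` supplies multipliers for it; other profiles
contribute nothing. The Stirling factors are polynomial in `|E|` since `w`, `r` and `v` are at most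
`c d |E|`. -/
theorem card_profile_le_of_forall (A : Admissible c d t c₁) (hNJ : N * c = J * d)
    {E : Finset (Fin N)} (hE : E.Nonempty) (s : ℕ) (V : ℝ)
    (h : ∀ p, FeasiblePt c d t c₁ p → p 0 = E.card / N → (s : ℝ) / N ≤ p 1 + p 2 →
      ∃ x ∈ posSet, psiAt c d t c₁ x p - entropy ![p 0] ≤ V) (g l b w : ℕ) (hs : s ≤ g + l) :
    ((Finset.univ.filter fun π : Tanner N c J d => (stay t c₁ π E).card = g ∧
        (spread t c₁ π E).card = l ∧ (badChecks t π E).card = b ∧ badEdges t π E = w).card : ℝ)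
    ≤ (N * c).factorial * (Real.exp 3 * (2 * (c * d * E.card)) ^ 3) * Real.exp (N * V) := by
  rcases (Finset.univ.filter fun π : Tanner N c J d => (stay t c₁ π E).card = g ∧
        (spread t c₁ π E).card = l ∧ (badChecks t π E).card = b ∧
        badEdges t π E = w).eq_empty_or_nonempty with h0 | ⟨π, hπ⟩
  · rw [h0, Finset.card_empty, Nat.cast_zero]
    positivity
  obtain ⟨h1, h2, h3, h4⟩ : (stay t c₁ π E).card = g ∧ (spread t c₁ π E).card = l ∧
    (badChecks t π E).card = b ∧ badEdges t π E = w :=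
    (Finset.mem_filter.1 hπ).2
  have hpos : 0 < E.card := hE.card_pos
  have hle := Finset.card_le_univ E
  rw [Fintype.card_fin] at hle
  have hEc : Eᶜ.card = N - E.card := by rw [Finset.card_compl, Fintype.card_fin]
  have k1 := card_badChecks_mul_le t π E
  have k2 := card_stay_mul_le t c₁ π E
  have k3 := card_spread_mul_le t c₁ π E
  have k4 := badEdges_add_sum_compl t π E
  have k5 : (stay t c₁ π E).card ≤ E.card := Finset.card_filter_le _ _
  have k6 : (spread t c₁ π E).card ≤ Eᶜ.card := Finset.card_filter_le _ _
  have k7 : (badChecks t π E).card ≤ J := by simpa using Finset.card_le_univ (badChecks t π E)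
  have k8 : badEdges t π E ≤ E.card * c := sum_card_le_mul E _
  have k9 := sum_card_le_mul Eᶜ (badSockets t π E)
  rw [hEc] at k6 k9
  set v := ∑ i ∈ Eᶜ, (badSockets t π E i).card
  rw [h1, h4] at k2
  rw [h3, h4] at k1 k4
  rw [h2] at k3 k6
  rw [h1] at k5; rw [h3] at k7; rw [h4] at k8
  obtain ⟨g', hg'⟩ := Nat.exists_eq_add_of_le k5
  obtain ⟨l', hl'⟩ := Nat.exists_eq_add_of_le k6
  obtain ⟨b', hb'⟩ := Nat.exists_eq_add_of_le k7
  obtain ⟨r, hr⟩ := Nat.exists_eq_add_of_le k8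
  obtain ⟨z, hz⟩ := Nat.exists_eq_add_of_le k9
  have hn : E.card + (N - E.card) = N := by omega
  have hN : 0 < N := by omega
  have hcn : 0 < c := by have := A.lt_c; omega
  have hdn : 0 < d := by have := A.le_d; omega
  have hN' : (0 : ℝ) < N := by exact_mod_cast hN
  obtain ⟨x, hx, hxV⟩ := h (profilePt N c J E.card g l b w)
    (feasiblePt_profilePt A hN hNJ hn hg'.symm hl'.symm k4 hr.symm hz.symm k1 k2 k3) rfl
    (by
      change (s : ℝ) / N ≤ g / N + l / N
      rw [← add_div]
      gcongr
      exact_mod_cast hs)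
  have hmain := card_profile_le_exp (J := J) A E hn hg'.symm hl'.symm hb'.symm k4 hr.symm
    hz.symm hx
  refine hmain.trans ?_
  rw [profileExponent_eq x hN hcn hdn hNJ hn hg'.symm hl'.symm hb'.symm k4 hr.symm hz.symm]
  have m0 : 1 ≤ c * d * E.card := by
    have := Nat.mul_pos (Nat.mul_pos hcn hdn) hpos
    omega
  have m1 : w ≤ c * d * E.card := by
    refine k8.trans ?_
    rw [mul_comm E.card c]
    exact Nat.mul_le_mul_right _ (Nat.le_mul_of_pos_right _ hdn)
  have m2 : r ≤ c * d * E.card := by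
    refine (show r ≤ E.card * c by omega).trans ?_
    rw [mul_comm E.card c]
    exact Nat.mul_le_mul_right _ (Nat.le_mul_of_pos_right _ hdn)
  have m3 : v ≤ c * d * E.card := by
    have hbw : b ≤ E.card * c := (Nat.le_mul_of_pos_right b (Nat.succ_pos t)).trans (k1.trans k8)
    have := Nat.mul_le_mul_right d hbw
    calc v ≤ b * d := by omega
      _ ≤ E.card * c * d := this
      _ = c * d * E.card := by ring
  have m0' : (1 : ℝ) ≤ c * d * E.card := by exact_mod_cast m0
  have m1' : (w : ℝ) ≤ c * d * E.card := by exact_mod_cast m1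
  have m2' : (r : ℝ) ≤ c * d * E.card := by exact_mod_cast m2
  have m3' : (v : ℝ) ≤ c * d * E.card := by exact_mod_cast m3
  exact mul_succ_mul_exp_le (Nat.cast_nonneg _) (Nat.cast_nonneg _)
    (Nat.cast_nonneg _) m0' m1' m2' m3' (mul_le_mul_of_nonneg_left hxV hN'.le)

/-- The first-moment bound for a fixed error set. -/
theorem card_growth_le (A : Admissible c d t c₁) (hNJ : N * c = J * d)
    {E : Finset (Fin N)} (hE : E.Nonempty) (s : ℕ) (V : ℝ)
    (h : ∀ p, FeasiblePt c d t c₁ p → p 0 = E.card / N → (s : ℝ) / N ≤ p 1 + p 2 →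
      ∃ x ∈ posSet, psiAt c d t c₁ x p - entropy ![p 0] ≤ V) :
    ((Finset.univ.filter fun π : Tanner N c J d =>
        s ≤ (stay t c₁ π E).card + (spread t c₁ π E).card).card : ℝ)
    ≤ (N * c).factorial * (Real.exp 3 * (2 * (c * d)) ^ 7 * E.card ^ 7) * Real.exp (N * V) := by
  classical
  have hcn : 0 < c := by have := A.lt_c; omega
  have hdn : 0 < d := by have := A.le_d; omega
  have hpos : 0 < E.card := hE.card_pos
  set K := c * d * E.card with hK
  have hK1 : 1 ≤ K := by
    have := Nat.mul_pos (Nat.mul_pos hcn hdn) hpos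
    omega
  -- There are at most `(K + 1) ^ 4` profiles; with the three Stirling factors this gives the
  -- exponent `7`.
  set P := Finset.range (K + 1) ×ˢ Finset.range (K + 1) ×ˢ Finset.range (K + 1) ×ˢ
    Finset.range (K + 1) with hP
  set Z := Finset.univ.filter fun π : Tanner N c J d =>
        s ≤ (stay t c₁ π E).card + (spread t c₁ π E).card with hZ
  have hmap : Set.MapsTo (fun π : Tanner N c J d => ((stay t c₁ π E).card,
      (spread t c₁ π E).card, (badChecks t π E).card, badEdges t π E)) Z P := by
    intro π _
    have k1 := card_badChecks_mul_le t π E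
    have k3 := card_spread_mul_le t c₁ π E
    have k4 := badEdges_add_sum_compl t π E
    have k5 : (stay t c₁ π E).card ≤ E.card := Finset.card_filter_le _ _
    have k8 : badEdges t π E ≤ E.card * c := sum_card_le_mul E _
    have hbw : (badChecks t π E).card ≤ badEdges t π E :=
      (Nat.le_mul_of_pos_right _ (Nat.succ_pos t)).trans k1
    have hl : (spread t c₁ π E).card ≤ (badChecks t π E).card * d :=
      (Nat.le_mul_of_pos_right _ (by have := A.two_le; omega : 0 < c₁)).trans (k3.trans (by omega))
    have m1 : E.card ≤ K := Nat.le_mul_of_pos_left _ (Nat.mul_pos hcn hdn)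
    have m2 : E.card * c ≤ K := by
      rw [hK, mul_comm E.card c]
      exact Nat.mul_le_mul_right _ (Nat.le_mul_of_pos_right _ hdn)
    have m3 : (badChecks t π E).card * d ≤ K :=
      (Nat.mul_le_mul_right d (hbw.trans k8)).trans (by rw [hK]; exact le_of_eq (by ring))
    simp only [hP, Finset.coe_product, Set.mem_prod, Finset.mem_coe, Finset.mem_range]
    refine ⟨?_, ?_, ?_, ?_⟩ <;> omega
  rw [Finset.card_eq_sum_card_fiberwise hmap, Nat.cast_sum]
  refine (Finset.sum_le_card_nsmul P _ ((N * c).factorial * (Real.exp 3 * (2 * (c * d * E.card)) ^ 3)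
    * Real.exp (N * V)) ?_).trans ?_
  · rintro ⟨g, l, b, w⟩ -
    by_cases hs : s ≤ g + l
    · refine le_trans ?_ (card_profile_le_of_forall A hNJ hE s V h g l b w hs)
      refine Nat.cast_le.2 (Finset.card_le_card fun π hπ => ?_)
      simp only [Finset.mem_filter, Finset.mem_univ, true_and, Prod.mk.injEq] at hπ ⊢
      exact hπ.2
    · rw [Finset.card_eq_zero.2, Nat.cast_zero]
      · positivity
      · refine Finset.filter_eq_empty_iff.2 fun π hπ heq => hs ?_
        simp only [hZ, Finset.mem_filter, Finset.mem_univ, true_and, Prod.mk.injEq] at hπ heq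
        omega
  · rw [nsmul_eq_mul]
    have hPc : (P.card : ℝ) = ((K : ℝ) + 1) ^ 4 := by
      simp [hP]
      ring
    have hK1' : (1 : ℝ) ≤ K := by exact_mod_cast hK1
    have hKr : (K : ℝ) = c * d * E.card := by rw [hK]; push_cast; ring
    rw [hPc]
    calc ((K : ℝ) + 1) ^ 4 * ((N * c).factorial * (Real.exp 3 * (2 * (c * d * E.card)) ^ 3)
          * Real.exp (N * V))
        ≤ (2 * (K : ℝ)) ^ 4 * ((N * c).factorial * (Real.exp 3 * (2 * (c * d * E.card)) ^ 3)
          * Real.exp (N * V)) := by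
          gcongr
          linarith
      _ = _ := by rw [hKr]; ring

end

end GLDPC

namespace GLDPC

noncomputable section

variable {N c J d t c₁ : ℕ}

/-! ### The probability of a decoding failure -/

theorem card_tanner (hNJ : N * c = J * d) :
    Fintype.card (Tanner N c J d) = (N * c).factorial := by
  have e : Tanner N c J d := Fintype.equivOfCardEq (by simp [hNJ])
  rw [Fintype.card_equiv e]
  simp

/-- Failure requires that some small set `F` does not shrink, an event of the matching alone, or
that the drawn `E` stays large after one iteration. Only the first event costs a sum over sets; in
the second, `E` is averaged out. -/
theorem one_sub_successProb_le {C₀ : Submodule (ZMod 2) (Fin d → ZMod 2)}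
    (hC₀ : ∀ w ∈ C₀, w ≠ 0 → 2 * t + 1 ≤ hammingNorm w) (hcc : c₁ ≤ c) (hc₁ : 0 < c₁)
    (hNJ : N * c = J * d) {n : ℕ} (hn : n ≤ N) (m : ℕ) (a : ℕ → ℝ) (b : ℝ)
    (ha : ∀ F : Finset (Fin N), F.Nonempty → F.card ≤ m →
      ((Finset.univ.filter fun π : Tanner N c J d =>
        F.card ≤ (stay t c₁ π F).card + (spread t c₁ π F).card).card : ℝ)
        ≤ (N * c).factorial * a F.card)
    (hb : ∀ E : Finset (Fin N), E.card = n →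
      ((Finset.univ.filter fun π : Tanner N c J d =>
        m + 1 ≤ (stay t c₁ π E).card + (spread t c₁ π E).card).card : ℝ)
        ≤ (N * c).factorial * b) :
    1 - successProb C₀ t c₁ N c J n ≤ ∑ k ∈ Finset.Icc 1 m, N.choose k * a k + b := by
  classical
  set Ω : Finset (Tanner N c J d × Finset (Fin N)) :=
    Finset.univ ×ˢ Finset.powersetCard n Finset.univ with hΩ
  have hΩc : Ω.card = (N * c).factorial * N.choose n := by
    rw [hΩ, Finset.card_product, Finset.card_univ, card_tanner hNJ, Finset.card_powersetCard,
      Finset.card_univ, Fintype.card_fin]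
  have hΩpos : (0 : ℝ) < Ω.card := by
    rw [hΩc]
    exact_mod_cast Nat.mul_pos (Nat.factorial_pos _) (Nat.choose_pos hn)
  have hsucc : successProb C₀ t c₁ N c J n
      = ((Ω.filter fun p => Corrects C₀ t c₁ p.1 p.2).card : ℝ) / Ω.card := by
    unfold successProb
    simp only [hΩ]
  have hsplit : ((Ω.filter fun p => Corrects C₀ t c₁ p.1 p.2).card : ℝ)
      + (Ω.filter fun p => ¬ Corrects C₀ t c₁ p.1 p.2).card = Ω.card := by
    exact_mod_cast Finset.card_filter_add_card_filter_not _
  set Bad₁ : Finset (Tanner N c J d × Finset (Fin N)) :=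
    (Finset.Icc 1 m).biUnion fun k => (Finset.powersetCard k Finset.univ).biUnion fun F =>
      (Finset.univ.filter fun π : Tanner N c J d =>
        F.card ≤ (stay t c₁ π F).card + (spread t c₁ π F).card)
        ×ˢ Finset.powersetCard n Finset.univ with hBad₁
  set Bad₂ : Finset (Tanner N c J d × Finset (Fin N)) :=
    (Finset.powersetCard n Finset.univ).biUnion fun E =>
      (Finset.univ.filter fun π : Tanner N c J d =>
        m + 1 ≤ (stay t c₁ π E).card + (spread t c₁ π E).card) ×ˢ {E} with hBad₂
  have hsub : (Ω.filter fun p => ¬ Corrects C₀ t c₁ p.1 p.2) ⊆ Bad₁ ∪ Bad₂ := by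
    rintro ⟨π, E⟩ hp
    rw [Finset.mem_filter, hΩ, Finset.mem_product] at hp
    obtain ⟨⟨-, hE⟩, hcor⟩ := hp
    by_contra hnot
    rw [Finset.mem_union, not_or] at hnot
    refine hcor (corrects_of_forall_shrink (m := m) hC₀ hcc hc₁ (fun F hF hFm => ?_) ?_)
    · by_contra! hle
      refine hnot.1 (Finset.mem_biUnion.2 ⟨F.card, Finset.mem_Icc.2 ⟨hF.card_pos, hFm⟩,
        Finset.mem_biUnion.2 ⟨F, Finset.mem_powersetCard.2 ⟨Finset.subset_univ _, rfl⟩,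
          Finset.mem_product.2 ⟨?_, hE⟩⟩⟩)
      exact Finset.mem_filter.2 ⟨Finset.mem_univ _, hle⟩
    · by_contra! hle
      refine hnot.2 (Finset.mem_biUnion.2 ⟨E, hE, Finset.mem_product.2 ⟨?_,
        Finset.mem_singleton_self _⟩⟩)
      exact Finset.mem_filter.2 ⟨Finset.mem_univ _, hle⟩
  have hB₁ : (Bad₁.card : ℝ) ≤ Ω.card * ∑ k ∈ Finset.Icc 1 m, N.choose k * a k := by
    refine (Nat.cast_le.2 Finset.card_biUnion_le).trans ?_
    rw [Nat.cast_sum, Finset.mul_sum]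
    refine Finset.sum_le_sum fun k hk => ?_
    refine (Nat.cast_le.2 Finset.card_biUnion_le).trans ?_
    rw [Nat.cast_sum]
    refine (Finset.sum_le_card_nsmul _ _ ((N * c).factorial * a k * N.choose n) ?_).trans
      (le_of_eq ?_)
    · intro F hF
      have hFk := (Finset.mem_powersetCard.1 hF).2
      obtain ⟨hk1, hkm⟩ := Finset.mem_Icc.1 hk
      rw [Finset.card_product, Finset.card_powersetCard, Finset.card_univ, Fintype.card_fin,
        Nat.cast_mul, ← hFk]
      exact mul_le_mul_of_nonneg_right
        (ha F (Finset.card_pos.1 (by omega)) (by omega)) (Nat.cast_nonneg _)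
    · rw [Finset.card_powersetCard, Finset.card_univ, Fintype.card_fin, nsmul_eq_mul, hΩc]
      push_cast
      ring
  have hB₂ : (Bad₂.card : ℝ) ≤ Ω.card * b := by
    refine (Nat.cast_le.2 Finset.card_biUnion_le).trans ?_
    rw [Nat.cast_sum]
    refine (Finset.sum_le_card_nsmul _ _ ((N * c).factorial * b) ?_).trans (le_of_eq ?_)
    · intro E hE
      rw [Finset.card_product, Finset.card_singleton, mul_one]
      exact hb E (Finset.mem_powersetCard.1 hE).2
    · rw [Finset.card_powersetCard, Finset.card_univ, Fintype.card_fin, nsmul_eq_mul, hΩc]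
      push_cast
      ring
  have hfail : ((Ω.filter fun p => ¬ Corrects C₀ t c₁ p.1 p.2).card : ℝ)
      ≤ Bad₁.card + Bad₂.card := by
    exact_mod_cast (Finset.card_le_card hsub).trans (Finset.card_union_le _ _)
  rw [hsucc, sub_le_iff_le_add, ← sub_le_iff_le_add', le_div_iff₀ hΩpos]
  linarith

open Classical in
theorem successProb_le_one (C₀ : Submodule (ZMod 2) (Fin d → ZMod 2)) (t c₁ N c J n : ℕ) :
    successProb C₀ t c₁ N c J n ≤ 1 := by
  unfold successProb
  exact div_le_one_of_le₀ (Nat.cast_le.2 (Finset.card_filter_le _ _)) (Nat.cast_nonneg _)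

/-- The number of error sets of size `k` is compensated by the entropy in the bound for one fixed
set. -/
theorem choose_mul_exp_le_one {k : ℕ} (hN : 0 < N) (hk : k ≤ N) :
    (N.choose k : ℝ) * Real.exp (-(N * entropy ![(k : ℝ) / N])) ≤ 1 := by
  obtain ⟨j, rfl⟩ := Nat.exists_eq_add_of_le hk
  have hN' : (0 : ℝ) < ((k + j : ℕ) : ℝ) := by exact_mod_cast hN
  have h := choose_le_exp (rfl : k + j = k + j)
  have e1 := mul_negMulLog_div (k := k) hN'
  have e2 := mul_negMulLog_div (k := j) hN'
  have e3 : 1 - (k : ℝ) / ((k + j : ℕ) : ℝ) = j / ((k + j : ℕ) : ℝ) := by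
    field_simp
    push_cast
    ring
  rw [entropy_one, e3, mul_add, e1, e2, Real.exp_neg, ← div_eq_mul_inv,
    div_le_one (Real.exp_pos _)]
  refine h.trans (le_of_eq ?_)
  congr 1
  push_cast
  ring

/-! ### Asymptotics -/

/-- The bound for the number of error sets of size `k ≤ ε N` that grow. -/
def smallTerm (B κ C ε : ℝ) (N k : ℕ) : ℝ :=
  if 0 < k ∧ (k : ℝ) ≤ ε * N then B * k ^ 7 * Real.exp (k * (κ * Real.log (k / N) + C)) else 0

section
variable {B κ C ε : ℝ}

theorem smallTerm_nonneg (hB : 0 ≤ B) (N k : ℕ) : 0 ≤ smallTerm B κ C ε N k := by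
  unfold smallTerm
  split_ifs <;> positivity

theorem smallTerm_le (hB : 0 ≤ B)
    (hε : ∀ a, 0 < a → a ≤ ε → κ * Real.log a + C ≤ -1) (N k : ℕ) :
    smallTerm B κ C ε N k ≤ B * ((k : ℝ) ^ 7 * Real.exp (-1 * k)) := by
  unfold smallTerm
  split_ifs with h
  · rw [mul_assoc]
    have hk : (0 : ℝ) < k := by exact_mod_cast h.1
    have hN : (0 : ℝ) < N := by
      rcases N.eq_zero_or_pos with rfl | hN
      · have := h.2
        simp at this
        omega
      · exact_mod_cast hN
    have := hε (k / N) (by positivity) (by rw [div_le_iff₀ hN]; exact h.2)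
    refine mul_le_mul_of_nonneg_left (mul_le_mul_of_nonneg_left (Real.exp_le_exp.2 ?_)
      (by positivity)) hB
    linarith [mul_le_mul_of_nonneg_left this hk.le]
  · positivity

theorem summable_smallTerm_bound : Summable fun k : ℕ => B * ((k : ℝ) ^ 7 * Real.exp (-1 * k)) :=
  (Real.summable_pow_mul_exp_neg_nat_mul 7 one_pos).mul_left B

theorem tendsto_smallTerm (hB : 0 ≤ B) (hκ : 0 < κ) (k : ℕ) :
    Tendsto (fun N => smallTerm B κ C ε N k) atTop (𝓝 0) := by
  rcases k.eq_zero_or_pos with rfl | hk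
  · simp [smallTerm]
  have hk' : (0 : ℝ) < k := by exact_mod_cast hk
  have h1 : Tendsto (fun N : ℕ => Real.log ((k : ℝ) / N)) atTop atBot := by
    refine Real.tendsto_log_nhdsGT_zero.comp (tendsto_nhdsWithin_iff.2 ⟨?_, ?_⟩)
    · exact tendsto_const_div_atTop_nhds_zero_nat _
    · filter_upwards [eventually_gt_atTop 0] with N hN
      have : (0 : ℝ) < N := by exact_mod_cast hN
      exact div_pos hk' this
  have h2 : Tendsto (fun N : ℕ => (k : ℝ) * (κ * Real.log ((k : ℝ) / N) + C)) atTop atBot :=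
    (tendsto_atBot_add_const_right _ C (h1.const_mul_atBot hκ)).const_mul_atBot hk'
  have h3 := (Real.tendsto_exp_atBot.comp h2).const_mul (B * (k : ℝ) ^ 7)
  rw [mul_zero] at h3
  refine squeeze_zero (fun N => smallTerm_nonneg hB N k) (fun N => ?_) h3
  unfold smallTerm
  split_ifs
  · rfl
  · simp only [Function.comp]
    positivity

/-- Each fixed `k` contributes a null sequence since `κ log (k / N) → -∞`, and `B k ^ 7 e ^ (-k)` is
a summable majorant. -/
theorem tendsto_tsum_smallTerm (hB : 0 ≤ B) (hκ : 0 < κ)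
    (hε : ∀ a, 0 < a → a ≤ ε → κ * Real.log a + C ≤ -1) :
    Tendsto (fun N => ∑' k, smallTerm B κ C ε N k) atTop (𝓝 0) := by
  have := tendsto_tsum_of_dominated_convergence (𝓕 := atTop)
    (f := fun N k => smallTerm B κ C ε N k) (g := fun _ => (0 : ℝ))
    (summable_smallTerm_bound (B := B)) (fun k => tendsto_smallTerm hB hκ k)
    (Eventually.of_forall fun N k => by
      rw [Real.norm_of_nonneg (smallTerm_nonneg hB N k)]
      exact smallTerm_le hB hε N k)
  simpa using this

theorem sum_smallTerm_le_tsum (hB : 0 ≤ B)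
    (hε : ∀ a, 0 < a → a ≤ ε → κ * Real.log a + C ≤ -1) (N : ℕ) (S : Finset ℕ) :
    ∑ k ∈ S, smallTerm B κ C ε N k ≤ ∑' k, smallTerm B κ C ε N k :=
  (Summable.of_nonneg_of_le (smallTerm_nonneg hB N) (smallTerm_le hB hε N)
    summable_smallTerm_bound).sum_le_tsum S fun k _ => smallTerm_nonneg hB N k

end

theorem tendsto_pow_mul_exp_neg (B : ℝ) (i : ℕ) {η : ℝ} (hη : 0 < η) :
    Tendsto (fun N : ℕ => B * ((N : ℝ) ^ i * Real.exp (-η * N))) atTop (𝓝 0) := by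
  have := (Real.summable_pow_mul_exp_neg_nat_mul i hη).tendsto_atTop_zero.const_mul B
  simpa using this

/-- With `m = n = 0` both failure terms are zero: no nonempty set has size `0`, and the empty set
produces no errors. -/
theorem tendsto_successProb_zero (A : Admissible c d t c₁)
    {C₀ : Submodule (ZMod 2) (Fin d → ZMod 2)}
    (hC₀ : ∀ w ∈ C₀, w ≠ 0 → 2 * t + 1 ≤ hammingNorm w) :
    Tendsto (fun N : ℕ => successProb C₀ t c₁ N c (N * c / d) 0)
      (atTop ⊓ 𝓟 {N : ℕ | d ∣ N * c}) (𝓝 1) := by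
  refine tendsto_const_nhds.congr' ?_
  rw [EventuallyEq, eventually_inf_principal]
  refine Eventually.of_forall fun N hdvd => ?_
  have hc₁ : 0 < c₁ := by have := A.two_le; omega
  have h := one_sub_successProb_le hC₀ A.lt_c.le hc₁ (Nat.div_mul_cancel hdvd).symm
    (Nat.zero_le N) 0 (fun _ => 0) 0 (fun F hF h0 => by
      have := hF.card_pos; omega) (fun E hE => by
      rw [Finset.card_eq_zero.1 hE]
      have he := fun π : Tanner N c (N * c / d) d =>
        Finset.union_eq_empty.1 (stay_union_spread_empty (t := t) (π := π) hc₁)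
      simp [he])
  have h2 := successProb_le_one C₀ t c₁ N c (N * c / d) 0
  simp at h
  linarith

theorem tendsto_successProb (A : Admissible c d t c₁)
    {C₀ : Submodule (ZMod 2) (Fin d → ZMod 2)}
    (hC₀ : ∀ w ∈ C₀, w ≠ 0 → 2 * t + 1 ≤ hammingNorm w) {α₀ α : ℝ} (hα₀ : 0 < α₀)
    (hneg : ∀ a, 0 < a → a < α₀ → f c d t c₁ a < 0) (hα : 0 < α) (hα1 : α ≤ 1)
    (hfR : fR c d t c₁ α α₀ < 0) :
    Tendsto (fun N : ℕ => successProb C₀ t c₁ N c (N * c / d) ⌊α * N⌋₊)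
      (atTop ⊓ 𝓟 {N : ℕ | d ∣ N * c}) (𝓝 1) := by
  obtain ⟨κ, C, ε, hκ, hε0, -, hε, hsmall⟩ := exists_smallFraction A
  obtain ⟨η₁, hη₁, hfirst⟩ := exists_first_step_bound A hα hfR
  -- Within the tolerance `η₁` of the first iteration, yet positive and strictly below `α₀`, so that
  -- the growth bound applies up to `ν`.
  set ν := max (α₀ - η₁) (α₀ / 2) with hν
  have hν0 : 0 < ν := lt_max_of_lt_right (by linarith)
  have hνα : ν < α₀ := max_lt (by linarith) (by linarith)
  obtain ⟨η, hη, hgrow⟩ := exists_growth_bound A hneg hε0 hνα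
  set B : ℝ := Real.exp 3 * (2 * (c * d)) ^ 7 with hB
  have hB0 : 0 ≤ B := by positivity
  have hc₁ : 0 < c₁ := by have := A.two_le; omega
  -- The summands treat sets of size at most `ε N`, larger sets up to `ν N` (one extra power of `N`
  -- for the number of sizes), and the first iteration.
  let err : ℕ → ℝ := fun N => ∑' k, smallTerm B κ C ε N k
    + B * ((N : ℝ) ^ 8 * Real.exp (-η * N)) + B * ((N : ℝ) ^ 7 * Real.exp (-η₁ * N))
  have herr : Tendsto err atTop (𝓝 0) := by
    have := ((tendsto_tsum_smallTerm hB0 hκ hε).add (tendsto_pow_mul_exp_neg B 8 hη)).add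
      (tendsto_pow_mul_exp_neg B 7 hη₁)
    simpa [err] using this
  have hlow : Tendsto (fun N => 1 - err N) (atTop ⊓ 𝓟 {N : ℕ | d ∣ N * c}) (𝓝 1) := by
    have := (herr.const_sub 1).mono_left (inf_le_left (b := 𝓟 {N : ℕ | d ∣ N * c}))
    simpa using this
  refine tendsto_of_tendsto_of_tendsto_of_le_of_le' hlow tendsto_const_nhds ?_
    (Eventually.of_forall fun N => successProb_le_one _ _ _ _ _ _ _)
  rw [eventually_inf_principal]
  have hfl : Tendsto (fun N : ℕ => (⌊α * N⌋₊ : ℝ) / N) atTop (𝓝 α) :=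
    (tendsto_nat_floor_mul_div_atTop hα.le).comp tendsto_natCast_atTop_atTop
  filter_upwards [eventually_gt_atTop 0, hfl.eventually (eventually_gt_nhds hα),
    hfl.eventually (Metric.closedBall_mem_nhds α hη₁)] with N hN hnpos hnear hdvd
  have hN' : (0 : ℝ) < N := by exact_mod_cast hN
  set J := N * c / d
  have hNJ : N * c = J * d := (Nat.div_mul_cancel hdvd).symm
  set n := ⌊α * N⌋₊ with hn
  have hn0 : 0 < n := by
    rcases n.eq_zero_or_pos with h | h
    · rw [h] at hnpos; simp at hnpos
    · exact h
  have hnN : n ≤ N := by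
    have h1 : (n : ℝ) ≤ α * N := Nat.floor_le (by positivity)
    have h2 : (n : ℝ) ≤ N := h1.trans (by nlinarith)
    exact_mod_cast h2
  set m := ⌊ν * N⌋₊ with hm
  have hmν : (m : ℝ) ≤ ν * N := Nat.floor_le (by positivity)
  have hm1 : ν * N < m + 1 := Nat.lt_floor_add_one _
  let V : ℕ → ℝ := fun k =>
    if (k : ℝ) ≤ ε * N then (k : ℝ) / N * (κ * Real.log (k / N) + C) else -η
  have hV : ∀ F : Finset (Fin N), F.Nonempty → F.card ≤ m →
      ((Finset.univ.filter fun π : Tanner N c J d =>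
        F.card ≤ (stay t c₁ π F).card + (spread t c₁ π F).card).card : ℝ)
        ≤ (N * c).factorial * (B * F.card ^ 7
          * Real.exp (N * (V F.card - entropy ![(F.card : ℝ) / N]))) := by
    intro F hF hFm
    rw [← mul_assoc]
    refine card_growth_le A hNJ hF F.card _ fun p hp hp0 hps => ?_
    have hk0 : (0 : ℝ) < F.card := by exact_mod_cast hF.card_pos
    have hp0' : 0 < p 0 := by rw [hp0]; exact div_pos hk0 hN'
    by_cases hk : (F.card : ℝ) ≤ ε * N
    · obtain ⟨x, hx, hle⟩ := hsmall p hp hp0' (by linarith)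
      refine ⟨x, hx, ?_⟩
      simp only [V, if_pos hk]
      rw [← hp0]
      linarith
    · have hkm : (F.card : ℝ) ≤ ν * N := le_trans (by exact_mod_cast hFm) hmν
      obtain ⟨x, hx, hle⟩ := hgrow p ⟨hp, by rw [hp0, le_div_iff₀ hN']; linarith,
        by rw [hp0, div_le_iff₀ hN']; exact hkm, by linarith⟩
      refine ⟨x, hx, ?_⟩
      simp only [V, if_neg hk]
      rw [← hp0]
      linarith
  have hfin := one_sub_successProb_le hC₀ A.lt_c.le hc₁ hNJ hnN m
    (fun k => B * (k : ℝ) ^ 7 * Real.exp (N * (V k - entropy ![(k : ℝ) / N])))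
    (B * n ^ 7 * Real.exp (N * -η₁)) hV (fun E hE => by
      have hEne : E.Nonempty := Finset.card_pos.1 (by omega)
      have := card_growth_le (J := J) A hNJ hEne (m + 1) (-η₁) fun p hp hp0 hps => by
        refine hfirst p hp ?_ ?_
        · rw [hp0, hE]
          simpa [Real.dist_eq] using hnear
        · refine le_trans (le_trans (b := ν) (le_max_left _ _) ?_) hps
          rw [le_div_iff₀ hN']
          push_cast
          exact hm1.le
      rw [hE] at this
      rw [← mul_assoc]
      exact this)
  have hsum : ∑ k ∈ Finset.Icc 1 m, (N.choose k : ℝ) * (B * (k : ℝ) ^ 7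
        * Real.exp (N * (V k - entropy ![(k : ℝ) / N])))
      ≤ ∑' k, smallTerm B κ C ε N k + B * ((N : ℝ) ^ 8 * Real.exp (-η * N)) := by
    -- Sizes `k > N` are allowed formally, since `m ≤ N` is not known here; their binomial
    -- coefficient vanishes.
    have hterm : ∀ k ∈ Finset.Icc 1 m, (N.choose k : ℝ) * (B * (k : ℝ) ^ 7
        * Real.exp (N * (V k - entropy ![(k : ℝ) / N])))
        ≤ smallTerm B κ C ε N k
          + (if k ∈ Finset.Icc 1 N then B * ((N : ℝ) ^ 7 * Real.exp (-η * N)) else 0) := by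
      intro k hk
      have hk1 := (Finset.mem_Icc.1 hk).1
      rcases le_or_gt k N with hkN | hkN
      · have h1 : (N.choose k : ℝ) * (B * (k : ℝ) ^ 7
            * Real.exp (N * (V k - entropy ![(k : ℝ) / N])))
            ≤ B * (k : ℝ) ^ 7 * Real.exp (N * V k) := by
          have h2 := mul_le_mul_of_nonneg_left (choose_mul_exp_le_one hN hkN)
            (show 0 ≤ B * (k : ℝ) ^ 7 * Real.exp (N * V k) by positivity)
          rw [mul_one] at h2
          refine le_trans (le_of_eq ?_) h2
          rw [mul_sub, sub_eq_add_neg, Real.exp_add]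
          ring
        refine h1.trans ?_
        have hkN' : (k : ℝ) ≤ N := by exact_mod_cast hkN
        rw [if_pos (Finset.mem_Icc.2 ⟨hk1, hkN⟩)]
        by_cases hkε : (k : ℝ) ≤ ε * N
        · have h3 : B * (k : ℝ) ^ 7 * Real.exp (N * V k) = smallTerm B κ C ε N k := by
            unfold smallTerm
            rw [if_pos ⟨hk1, hkε⟩]
            simp only [V, if_pos hkε]
            congr 2
            field_simp
          rw [h3]
          exact le_add_of_nonneg_right (by positivity)
        · refine le_trans ?_ (le_add_of_nonneg_left (smallTerm_nonneg hB0 N k))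
          simp only [V, if_neg hkε]
          rw [mul_assoc, show (N : ℝ) * -η = -η * N by ring]
          gcongr
      · rw [Nat.choose_eq_zero_of_lt hkN, Nat.cast_zero, zero_mul]
        exact add_nonneg (smallTerm_nonneg hB0 N k) (by split_ifs <;> positivity)
    refine (Finset.sum_le_sum hterm).trans ?_
    rw [Finset.sum_add_distrib]
    refine add_le_add (sum_smallTerm_le_tsum hB0 hε N _) ?_
    rw [← Finset.sum_filter]
    refine (Finset.sum_le_sum_of_subset_of_nonneg (t := Finset.Icc 1 N) (fun k hk =>
      (Finset.mem_filter.1 hk).2) fun _ _ _ => by positivity).trans (le_of_eq ?_)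
    rw [Finset.sum_const, Nat.card_Icc, nsmul_eq_mul]
    simp
    ring
  have hlast : B * (n : ℝ) ^ 7 * Real.exp (N * -η₁)
      ≤ B * ((N : ℝ) ^ 7 * Real.exp (-η₁ * N)) := by
    have : (n : ℝ) ≤ N := by exact_mod_cast hnN
    rw [mul_assoc, show (N : ℝ) * -η₁ = -η₁ * N by ring]
    gcongr
  simp only [err]
  linarith

end

end GLDPC

/-! ### The theorem -/

theorem theorem2 (c d t c₁ : ℕ) (ht : 0 < t) (hd : 2 * t + 1 ≤ d) (hc₁ : 2 ≤ c₁)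
    (hc : 1 < ((c : ℝ) - c₁ + 1) * ((t : ℝ) / (t + 1))) :
    ∃ α₀ α_R : ℝ,
      IsLeast {α : ℝ | 0 < α ∧ GLDPC.f c d t c₁ α = 0} α₀ ∧
      IsGreatest {a : ℝ | 0 < a ∧ ∀ α : ℝ, 0 < α → α < a → GLDPC.fR c d t c₁ α α₀ < 0} α_R ∧
      ∀ C₀ : Submodule (ZMod 2) (Fin d → ZMod 2),
        (∀ w ∈ C₀, w ≠ 0 → 2 * t + 1 ≤ hammingNorm w) →
        ∀ α : ℝ, 0 ≤ α → α < α_R →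
          Tendsto (fun N : ℕ => GLDPC.successProb C₀ t c₁ N c (N * c / d) ⌊α * N⌋₊)
            (atTop ⊓ 𝓟 {N : ℕ | d ∣ N * c}) (𝓝 1) := by
  have A := GLDPC.Admissible.of_gain ht hd hc₁ hc
  obtain ⟨α₀, hα₀, h1, hneg⟩ := GLDPC.exists_isLeast_root A
  obtain ⟨α_R, hR, hR1⟩ := GLDPC.exists_isGreatest_threshold A hα₀.1.1 h1 hneg
  refine ⟨α₀, α_R, hα₀, hR, fun C₀ hC₀ α h0 hlt => ?_⟩
  -- The exponents need `α > 0`; without errors, success is immediate.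
  rcases h0.eq_or_lt with rfl | hpos
  · simpa using GLDPC.tendsto_successProb_zero A hC₀
  · exact GLDPC.tendsto_successProb A hC₀ hα₀.1.1 hneg hpos (hlt.le.trans hR1)
      (hR.1.2 α hpos hlt)
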